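/- Let $N\in\mathbb N$, let $0<\zeta_1<\dots<\zeta_N$ and $b_1,\dots,b_N>0$, and let $\mu=\sum_{j=1}^N b_j\delta_{\zeta_j}$. For integers $i,j$ put $$\beta_j=\int x^j\,d\mu(x),\qquad I_{i,j}=\iint\frac{x^iy^j}{x+y}\,d\mu(x)\,d\mu(y),\qquad J_{i,j}=\iint\frac{y-x}{x+y}\,x^iy^j\,d\mu(x)\,d\mu(y).$$ Let $F_k^{(i,j)}=\det(I_{i+p,j+q})_{p,q=0}^{k-1}$ (with $F_0^{(i,j)}=1$ and $F_k^{(i,j)}=0$ for $k<0$). For $k\ge1$ let $G_k^{(i,j)}$ be the $k\times k$ determinant with rows $(I_{i+p,j},I_{i+p,j+1},\dots,I_{i+p,j+k-2},\beta_{i+p})$, $p=0,\dots,k-1$ (so $G_1^{(i,j)}=\beta_i$). Let $\tau_k^{(l)}$ be the Pfaffian of $(J_{l+i,l+j})_{i,j=0}^{k-1}$ if $k\ge 0$ is even, and the Pfaffian of the same matrix bordered by the first row $(0,\beta_l,\dots,\beta_{l+k-1})$ and the first column $(0,-\beta_l,\dots,-\beta_{l+k-1})^{T}$ if $k\ge1$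 is odd; $\tau_0^{(l)}=1$ and $\tau_k^{(l)}=0$ for $k<0$. Put $$U_k=\tau_k^{(0)},\qquad W_k=\tau_k^{(1)}\tau_k^{(0)}-\tau_{k-1}^{(1)}\tau_{k+1}^{(0)},\qquad Z_k=\tau_k^{(-1)}\tau_k^{(0)}-\tau_{k+1}^{(-1)}\tau_{k-1}^{(0)}.$$ The *explicit Degasperis–Procesi (DP) formulae* are, for $1\le k\le N$, $$x_{N-k+1}=\ln\frac{2F_k^{(1,0)}}{G_k^{(0,2)}},\qquad m_{N-k+1}=\frac{(G_k^{(0,2)})^2}{2F_k^{(1,1)}F_{k-1}^{(1,1)}},\tag{DP}$$ and the *explicit Novikov formulae* are $$\tilde x_{N-k+1}=\frac12\ln\frac{Z_k}{W_{k-1}},\qquad \tilde m_{N-k+1}=\frac{\sqrt{Z_kW_{k-1}}}{U_kU_{k-1}}.\tag{NV}$$ Consider the maps $\Phi:(x,m)\mapsto(\tilde x,\tilde m)$ and $\Psi:(\tilde x,\tilde m)\mapsto(x,m)$ given by $$\Phi:\quad \tilde x_k=\frac12\ln\Big(\sum_{j=1}^k m_je^{2x_j}\Big),\qquad \tilde m_k=\big(e^{-x_k}-e^{-x_{k+1}}\big)e^{\tilde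 x_k},$$ $$\Psi:\quad x_k=-\ln\Big(\sum_{j=k}^N\tilde m_je^{-\tilde x_j}\Big),\qquad m_k=\big(e^{2\tilde x_k}-e^{2\tilde x_{k-1}}\big)e^{-2x_k},$$ with the conventions $x_{N+1}=+\infty$ and $\tilde x_0=-\infty$. (1) The formulae are meaningful: $F_k^{(1,0)},F_k^{(1,1)},F_k^{(2,1)},\tau_k^{(0)},\tau_k^{(1)},U_k,W_k,Z_k$ are positive for $0\le k\le N$ and $G_k^{(0,2)}>0$ for $1\le k\le N$; moreover $W_k=2^kF_k^{(1,1)}$ and $Z_k=2^kF_k^{(0,0)}$ for $0\le k\le N$, and the quantities in (DP) have for $1\le k\le N$ the equivalent forms $$x_{N-k+1}=\ln\frac{G_k^{(0,2)}}{F_{k-1}^{(2,1)}}=\frac12\ln\frac{2F_k^{(1,0)}}{F_{k-1}^{(2,1)}}=\ln\frac{\tau_k^{(0)}}{\tau_{k-1}^{(1)}},\qquad m_{N-k+1}=\frac{F_k^{(1,0)}F_{k-1}^{(2,1)}}{F_k^{(1,1)}F_{k-1}^{(1,1)}}.$$ Both formulae give points of the phase spaces, i.e. $x_1<\dots<x_N$,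 $m_k>0$, and $\tilde x_1<\dots<\tilde x_N$, $\tilde m_k>0$. (2) $\Phi$ sends the data (DP) exactly to the data (NV), and $\Psi$ sends the data (NV) exactly to the data (DP), for the same $\zeta_j$, $b_j$. (3) Consider the set of all explicit DP $N$-peakon trajectories, that is of all $t\mapsto(x(t),m(t))$, $t\in\mathbb R$, given by (DP) with constants $0<\zeta_1<\dots<\zeta_N$ and $b_j=b_j(t)>0$ satisfying $\dot b_j=b_j/\zeta_j$, and the set of all explicit Novikov $N$-peakon trajectories, that is of all $t\mapsto(\tilde x(t),\tilde m(t))$ given by (NV) with constants $0<\zeta_1<\dots<\zeta_N$ and $b_j(t)=b_j(0)e^{t/\zeta_j}>0$. Applied at each time $t$, $\Phi$ is a bijection of the first set onto the second, $\Psi$ is a bijection of the second onto the first, and they are inverse to each other on these sets. -/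

import Mathlib

open MeasureTheory

noncomputable section

namespace Peakon

/-! ### Moments, bimoments, determinants and Pfaffians of a measure -/

/-- The moment `β_j = ∫ x^j dμ(x)`, `j ∈ ℤ`. -/
def beta (μ : Measure ℝ) (j : ℤ) : ℝ := ∫ x, x ^ j ∂μ

/-- The Cauchy bimoment `I_{i,j} = ∬ x^i y^j / (x + y) dμ(x) dμ(y)`. -/
def bimomentI (μ : Measure ℝ) (i j : ℤ) : ℝ :=
  ∫ x, ∫ y, x ^ i * y ^ j / (x + y) ∂μ ∂μ

/-- The skew bimoment `J_{i,j} = ∬ (y - x) / (x + y) x^i y^j dμ(x) dμ(y)`. -/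
def bimomentJ (μ : Measure ℝ) (i j : ℤ) : ℝ :=
  ∫ x, ∫ y, (y - x) / (x + y) * x ^ i * y ^ j ∂μ ∂μ

/-- `F_k^{(i,j)} = det (I_{i+p,j+q})_{p,q=0}^{k-1}`, with `F_0 = 1` and `F_k = 0` for `k < 0`. -/
def F (μ : Measure ℝ) (i j : ℤ) : ℤ → ℝ
  | Int.ofNat k =>
      (Matrix.of fun p q : Fin k => bimomentI μ (i + (p : ℕ)) (j + (q : ℕ))).det
  | Int.negSucc _ => 0

/-- `G_k^{(i,j)}` for `k ≥ 1`: the `k × k` determinant whose first `k - 1` columns are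
`(I_{i+p,j+q})_p`, `q = 0, …, k - 2`, and whose last column is `(β_{i+p})_p`
(so `G_1 = β_i`); `G_k = 0` for `k < 1`. -/
def G (μ : Measure ℝ) (i j : ℤ) : ℤ → ℝ
  | Int.ofNat 0 => 0
  | Int.ofNat (k + 1) =>
      (Matrix.of fun p q : Fin (k + 1) =>
        if (q : ℕ) < k then bimomentI μ (i + (p : ℕ)) (j + (q : ℕ))
        else beta μ (i + (p : ℕ))).det
  | Int.negSucc _ => 0

/-- The Pfaffian of a `2m × 2m` (skew-symmetric) matrix,
`∑_P (-1)^P a_{i_1 i_2} a_{i_3 i_4} ⋯ a_{i_{2m-1} i_{2m}}`, the sum being over the permutations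
with `i_{2l-1} < i_{2l}` and `i_1 < i_3 < ⋯ < i_{2m-1}` (indices are counted from `0` below).
For `m = 0` it is `1`. -/
def pfaffian (m : ℕ) (A : Matrix (Fin (2 * m)) (Fin (2 * m)) ℝ) : ℝ :=
  ∑ σ : Equiv.Perm (Fin (2 * m)) with
      (∀ l : Fin m, σ ⟨2 * l, by omega⟩ < σ ⟨2 * l + 1, by omega⟩) ∧
      (∀ l l' : Fin m, l < l' → σ ⟨2 * l, by omega⟩ < σ ⟨2 * l', by omega⟩),
    ((Equiv.Perm.sign σ : ℤ) : ℝ) *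
      ∏ l : Fin m, A (σ ⟨2 * l, by omega⟩) (σ ⟨2 * l + 1, by omega⟩)

/-- `τ_k^{(l)}`: the Pfaffian of `(J_{l+i,l+j})_{i,j=0}^{k-1}` for even `k ≥ 0`, the Pfaffian of the
same matrix bordered by the first row `(0, β_l, …, β_{l+k-1})` and the first column
`(0, -β_l, …, -β_{l+k-1})` for odd `k ≥ 1`, and `0` for `k < 0`. -/
def tau (μ : Measure ℝ) (l : ℤ) : ℤ → ℝ
  | Int.ofNat k =>
      if Even k then
        pfaffian (k / 2) (Matrix.of fun i j => bimomentJ μ (l + (i : ℕ)) (l + (j : ℕ)))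
      else
        pfaffian ((k + 1) / 2) (Matrix.of fun i j =>
          if (i : ℕ) = 0 then
            if (j : ℕ) = 0 then 0 else beta μ (l + (j : ℕ) - 1)
          else
            if (j : ℕ) = 0 then -beta μ (l + (i : ℕ) - 1)
            else bimomentJ μ (l + (i : ℕ) - 1) (l + (j : ℕ) - 1))
  | Int.negSucc _ => 0

/-- `U_k = τ_k^{(0)}`. -/
def U (μ : Measure ℝ) (k : ℤ) : ℝ := tau μ 0 k

/-- `W_k = τ_k^{(1)} τ_k^{(0)} - τ_{k-1}^{(1)} τ_{k+1}^{(0)}`. -/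
def W (μ : Measure ℝ) (k : ℤ) : ℝ := tau μ 1 k * tau μ 0 k - tau μ 1 (k - 1) * tau μ 0 (k + 1)

/-- `Z_k = τ_k^{(-1)} τ_k^{(0)} - τ_{k+1}^{(-1)} τ_{k-1}^{(0)}`. -/
def Z (μ : Measure ℝ) (k : ℤ) : ℝ :=
  tau μ (-1) k * tau μ 0 k - tau μ (-1) (k + 1) * tau μ 0 (k - 1)

/-- The discrete measure `∑_j b_j δ_{ζ_j}`. -/
def discreteMeasure {N : ℕ} (ζ b : Fin N → ℝ) : Measure ℝ :=
  ∑ j, ENNReal.ofReal (b j) • Measure.dirac (ζ j)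

/-! ### Peakon data, phase space and the two maps

The `k`-th peakon, `k = 1, …, N`, has index `k - 1` in `Fin N`. -/

/-- Positions and momenta of `N` peakons. -/
abbrev Data (N : ℕ) : Type := (Fin N → ℝ) × (Fin N → ℝ)

/-- The phase space `x_1 < ⋯ < x_N`, `m_k > 0` (the spaces `𝒫` and `𝒬` have the same conditions). -/
def phaseSpace (N : ℕ) : Set (Data N) := {d | StrictMono d.1 ∧ ∀ k, 0 < d.2 k}

/-- The map from Degasperis-Procesi data `(x, m)` to Novikov data `(x̃, m̃)`:
`x̃_k = (1/2) ln (∑_{j ≤ k} m_j e^{2 x_j})`, `m̃_k = (e^{-x_k} - e^{-x_{k+1}}) e^{x̃_k}`,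
where `x_{N+1} = ∞`. -/
def xmToYn {N : ℕ} (d : Data N) : Data N :=
  let y : Fin N → ℝ := fun k =>
    1 / 2 * Real.log (∑ j ∈ Finset.Iic k, d.2 j * Real.exp (2 * d.1 j))
  (y, fun k =>
    (Real.exp (-d.1 k) - if h : (k : ℕ) + 1 < N then Real.exp (-d.1 ⟨k + 1, h⟩) else 0) *
      Real.exp (y k))

/-- The map from Novikov data `(x̃, m̃)` to Degasperis-Procesi data `(x, m)`:
`x_k = -ln (∑_{j ≥ k} m̃_j e^{-x̃_j})`, `m_k = (e^{2 x̃_k} - e^{2 x̃_{k-1}}) e^{-2 x_k}`,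
where `x̃_0 = -∞`. -/
def ynToXm {N : ℕ} (d : Data N) : Data N :=
  let x : Fin N → ℝ := fun k =>
    -Real.log (∑ j ∈ Finset.Ici k, d.2 j * Real.exp (-d.1 j))
  (x, fun k =>
    (Real.exp (2 * d.1 k) -
        if 0 < (k : ℕ) then Real.exp (2 * d.1 ⟨k - 1, by omega⟩) else 0) *
      Real.exp (-2 * x k))

/-! ### The explicit formulae

The entry with index `i : Fin N` is the one with the label `N - k + 1` for `k = N - i`. -/

/-- Degasperis-Procesi: `x_{N-k+1} = ln (2 F_k^{(1,0)} / G_k^{(0,2)})` and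
`m_{N-k+1} = (G_k^{(0,2)})² / (2 F_k^{(1,1)} F_{k-1}^{(1,1)})`. -/
def dpFormula (N : ℕ) (μ : Measure ℝ) : Data N :=
  (fun i =>
    let k : ℤ := (N : ℤ) - (i : ℕ)
    Real.log (2 * F μ 1 0 k / G μ 0 2 k),
   fun i =>
    let k : ℤ := (N : ℤ) - (i : ℕ)
    G μ 0 2 k ^ 2 / (2 * F μ 1 1 k * F μ 1 1 (k - 1)))

/-- Novikov: `x̃_{N-k+1} = (1/2) ln (Z_k / W_{k-1})` and
`m̃_{N-k+1} = √(Z_k W_{k-1}) / (U_k U_{k-1})`. -/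
def nvFormula (N : ℕ) (μ : Measure ℝ) : Data N :=
  (fun i =>
    let k : ℤ := (N : ℤ) - (i : ℕ)
    1 / 2 * Real.log (Z μ k / W μ (k - 1)),
   fun i =>
    let k : ℤ := (N : ℤ) - (i : ℕ)
    Real.sqrt (Z μ k * W μ (k - 1)) / (U μ k * U μ (k - 1)))

/-- The explicit Degasperis-Procesi `N`-peakon trajectories: those given by the formulae with
`0 < ζ_1 < ⋯ < ζ_N` and `b_j(t) > 0`, `b_j'(t) = b_j(t) / ζ_j`. -/
def dpExplicit (N : ℕ) : Set (ℝ → Data N) :=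
  {c | ∃ (ζ : Fin N → ℝ) (b : ℝ → Fin N → ℝ),
    StrictMono ζ ∧ (∀ j, 0 < ζ j) ∧ (∀ t j, 0 < b t j) ∧
    (∀ t j, HasDerivAt (fun s => b s j) (b t j / ζ j) t) ∧
    ∀ t, c t = dpFormula N (discreteMeasure ζ (b t))}

/-- The explicit Novikov `N`-peakon trajectories: those given by the formulae with
`0 < ζ_1 < ⋯ < ζ_N` and `b_j(t) = b_j(0) e^{t / ζ_j} > 0`. -/
def nvExplicit (N : ℕ) : Set (ℝ → Data N) :=
  {c | ∃ (ζ : Fin N → ℝ) (b : ℝ → Fin N → ℝ),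
    StrictMono ζ ∧ (∀ j, 0 < ζ j) ∧ (∀ t j, 0 < b t j) ∧
    (∀ t j, b t j = b 0 j * Real.exp (t / ζ j)) ∧
    ∀ t, c t = nvFormula N (discreteMeasure ζ (b t))}

end Peakon

end

/-! Everything is expressed through the functions τ. Integrating 2x/(x+y) = 1 - (y-x)/(x+y) gives 2
I_{i+1,j} = β_i β_j - J_{i,j} (`MomentRelations`), so up to powers of 2 the determinants F^{(l+1,l)}
have the form det(ββᵀ - J) with J skew. Such a determinant equals det J plus the determinant of the
bordered matrix; the one of odd size vanishes and the other is a squared Pfaffian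
(`det_rankOneSub_eq_sq`). Polarising this identity shows that replacing the first column by β
produces a product of two τ's (`det_updateCol_rankOneSub`). Hence 2^k F_k^{(l+1,l)} is a square of τ
and G is a product of two τ's up to a power of 2. The Desnanot–Jacobi identity for the matrix with
first column β then yields 2^k F_k^{(l+1,l+1)} as the bilinear τ-expression that is W for l = 0 and
Z for l = -1.

Positivity has two sources. The diagonal F^{(l,l)} are Gram determinants of the positive definite
Cauchy kernel. The τ's are expanded by a Pfaffian Cauchy–Binet formula, and Schur's Pfaffian
together with the Vandermonde determinant makes every summand nonnegative (`pfaffian_schur_pos`);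
for odd size the border acts as an extra node at 0.

For the DP data, e^{-x_i} - e^{-x_{i+1}} is then a quotient with numerator W, and a second use of
Desnanot–Jacobi writes m_j e^{2x_j} as a difference, so that the sum in Φ telescopes to Z_k /
W_{k-1}; it stops because F_{N+1}^{(0,0)} = 0. This is `xmToYn_dpFormula`. Since Ψ ∘ Φ is the
identity on the phase space, the statement on Ψ follows without further computation, and the
trajectories correspond because b_j evolves in the same way on both sides. -/

noncomputable section

namespace Peakon

open Equiv Finset

/-! ### Pfaffians as sums over all permutations -/

/-- The `l`-th pair of indices `(2l, 2l+1)`. -/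
def pairEquiv (m : ℕ) : Fin m × Fin 2 ≃ Fin (2 * m) :=
  finProdFinEquiv.trans (finCongr (Nat.mul_comm m 2))

lemma pairEquiv_zero {m : ℕ} (l : Fin m) (h : 2 * (l : ℕ) < 2 * m) :
    (⟨2 * l, h⟩ : Fin (2 * m)) = pairEquiv m (l, 0) := by
  ext; simp [pairEquiv]

lemma pairEquiv_one {m : ℕ} (l : Fin m) (h : 2 * (l : ℕ) + 1 < 2 * m) :
    (⟨2 * l + 1, h⟩ : Fin (2 * m)) = pairEquiv m (l, 1) := by
  ext; simp [pairEquiv, add_comm]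

/-- The signed product of matrix entries attached to a permutation in the Pfaffian. -/
def pfTerm {m : ℕ} (A : Matrix (Fin (2 * m)) (Fin (2 * m)) ℝ) (σ : Perm (Fin (2 * m))) : ℝ :=
  ((Perm.sign σ : ℤ) : ℝ) * ∏ l : Fin m, A (σ (pairEquiv m (l, 0))) (σ (pairEquiv m (l, 1)))

/-- A permutation is a matching when every pair is increasing and the first entries increase. -/
def IsMatchingPerm {m : ℕ} (σ : Perm (Fin (2 * m))) : Prop :=
  (∀ l, σ (pairEquiv m (l, 0)) < σ (pairEquiv m (l, 1))) ∧
    StrictMono fun l => σ (pairEquiv m (l, 0))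

lemma pfaffian_eq_sum_matching [∀ m, DecidablePred (IsMatchingPerm (m := m))] {m : ℕ}
    (A : Matrix (Fin (2 * m)) (Fin (2 * m)) ℝ) :
    pfaffian m A = ∑ σ : Perm (Fin (2 * m)) with IsMatchingPerm σ, pfTerm A σ := by
  unfold pfaffian pfTerm
  simp only [pairEquiv_zero, pairEquiv_one]
  congr 1
  ext σ
  rw [mem_filter, mem_filter]
  exact Iff.rfl

/-- The permutation which flips the pairs by `h.2` and then permutes them by `h.1`. -/
def pairPerm {m : ℕ} (h : Perm (Fin m) × (Fin m → Perm (Fin 2))) : Perm (Fin (2 * m)) :=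
  (pairEquiv m).permCongr
    (prodCongrRight h.2 * (prodCongrLeft fun _ : Fin 2 => h.1 : Perm (Fin m × Fin 2)))

lemma pairPerm_apply {m : ℕ} (h : Perm (Fin m) × (Fin m → Perm (Fin 2))) (l : Fin m)
    (c : Fin 2) :
    pairPerm h (pairEquiv m (l, c)) = pairEquiv m (h.1 l, h.2 (h.1 l) c) := by
  simp [pairPerm, permCongr_apply]

/-- Permuting the pairs moves both slots in parallel, so that part contributes the square of a sign;
only the flips count. -/
lemma sign_pairPerm {m : ℕ} (h : Perm (Fin m) × (Fin m → Perm (Fin 2))) :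
    Perm.sign (pairPerm h) = ∏ l, Perm.sign (h.2 l) := by
  rw [pairPerm, Perm.sign_permCongr, Perm.sign_mul, Perm.sign_prodCongrRight,
    Perm.sign_prodCongrLeft]
  simp

lemma perm_fin_two (e : Perm (Fin 2)) : e = 1 ∨ e = swap 0 1 := by
  revert e; decide

/-- Each flip changes the sign of the permutation and, by skew-symmetry, of one matrix entry;
reordering the pairs only permutes the factors. -/
lemma pfTerm_mul_pairPerm {m : ℕ} {A : Matrix (Fin (2 * m)) (Fin (2 * m)) ℝ}
    (hA : ∀ i j, A j i = -A i j) (σ : Perm (Fin (2 * m)))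
    (h : Perm (Fin m) × (Fin m → Perm (Fin 2))) : pfTerm A (σ * pairPerm h) = pfTerm A σ := by
  unfold pfTerm
  have key : ∀ l : Fin m, A ((σ * pairPerm h) (pairEquiv m (l, 0)))
      ((σ * pairPerm h) (pairEquiv m (l, 1))) =
      ((Perm.sign (h.2 (h.1 l)) : ℤ) : ℝ) *
        A (σ (pairEquiv m (h.1 l, 0))) (σ (pairEquiv m (h.1 l, 1))) := by
    intro l
    rw [Perm.mul_apply, Perm.mul_apply, pairPerm_apply, pairPerm_apply]
    rcases perm_fin_two (h.2 (h.1 l)) with e | e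
    · simp [e]
    · simp [e]
      rw [hA]
  simp_rw [key]
  rw [prod_mul_distrib]
  rw [Equiv.prod_comp h.1 fun l => A (σ (pairEquiv m (l, 0))) (σ (pairEquiv m (l, 1)))]
  rw [Equiv.prod_comp h.1 fun l => ((Perm.sign (h.2 l) : ℤ) : ℝ)]
  rw [Perm.sign_mul, sign_pairPerm, ← mul_assoc]
  congr 1
  push_cast
  rw [mul_assoc, ← prod_mul_distrib]
  have : ∀ l, ((Perm.sign (h.2 l) : ℤ) : ℝ) * ((Perm.sign (h.2 l) : ℤ) : ℝ) = 1 := by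
    intro l
    rw [← Int.cast_mul, ← Units.val_mul, Int.units_mul_self]; simp
  simp [this]

/-- The order inside each pair forces the flips, and sorting the pairs by their smaller entries
forces the rest. -/
lemma existsUnique_isMatchingPerm {m : ℕ} (σ : Perm (Fin (2 * m))) :
    ∃! h : Perm (Fin m) × (Fin m → Perm (Fin 2)), IsMatchingPerm (σ * pairPerm h) := by
  have hne : ∀ l, σ (pairEquiv m (l, 0)) ≠ σ (pairEquiv m (l, 1)) := by
    intro l h
    have := (pairEquiv m).injective (σ.injective h)
    simp at this
  have hflip : ∀ l, ∃! e : Perm (Fin 2),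
      σ (pairEquiv m (l, e 0)) < σ (pairEquiv m (l, e 1)) := by
    intro l
    rcases lt_or_gt_of_ne (hne l) with h | h
    · refine ⟨1, by simpa using h, fun e he => ?_⟩
      rcases perm_fin_two e with rfl | rfl
      · rfl
      · simp at he; exact absurd he h.asymm
    · refine ⟨swap 0 1, by simpa using h, fun e he => ?_⟩
      rcases perm_fin_two e with rfl | rfl
      · simp at he; exact absurd he h.asymm
      · rfl
  choose ε hε huniq using hflip
  set g : Fin m → Fin (2 * m) := fun l => σ (pairEquiv m (l, ε l 0)) with hg
  have ginj : Function.Injective g := by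
    intro a b hab
    have := (pairEquiv m).injective (σ.injective hab)
    exact (Prod.mk.inj this).1
  refine ⟨(Tuple.sort g, ε), ⟨fun l => ?_, ?_⟩, ?_⟩
  · rw [Perm.mul_apply, Perm.mul_apply, pairPerm_apply, pairPerm_apply]
    exact hε _
  · simp only [Perm.mul_apply, pairPerm_apply]
    exact (Tuple.monotone_sort g).strictMono_of_injective
      (ginj.comp (Tuple.sort g).injective)
  · rintro ⟨π, ε'⟩ ⟨h1, h2⟩
    simp only [Perm.mul_apply, pairPerm_apply] at h1 h2
    have hε' : ε' = ε := by
      funext l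
      have := h1 (π.symm l)
      rw [Equiv.apply_symm_apply] at this
      exact huniq _ _ this
    subst hε'
    have hs : g ∘ π = g ∘ Tuple.sort g :=
      Tuple.unique_monotone (f := g) (σ := π) h2.monotone (Tuple.monotone_sort g)
    have : π = Tuple.sort g := by
      ext l
      rw [ginj (congrFun hs l)]
    rw [this]

/-- For a skew-symmetric matrix the sum of all Pfaffian terms is `2^m m!` times the Pfaffian. -/
theorem sum_pfTerm {m : ℕ} {A : Matrix (Fin (2 * m)) (Fin (2 * m)) ℝ}
    (hA : ∀ i j, A j i = -A i j) :
    ∑ σ, pfTerm A σ = (m.factorial * 2 ^ m : ℝ) * pfaffian m A := by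
  classical
  rw [pfaffian_eq_sum_matching]
  -- Each term is spread over its orbit under flips and reorderings, where exactly one element is a
  -- matching. After exchanging the sums, translation by `pairPerm h` gives the Pfaffian once for
  -- each of the m! 2^m choices of `h`.
  have h1 : ∀ σ, pfTerm A σ = ∑ h : Perm (Fin m) × (Fin m → Perm (Fin 2)),
      if IsMatchingPerm (σ * pairPerm h) then pfTerm A (σ * pairPerm h) else 0 := by
    intro σ
    obtain ⟨h, hh, hu⟩ := existsUnique_isMatchingPerm σ
    rw [Finset.sum_eq_single h]
    · rw [if_pos hh, pfTerm_mul_pairPerm hA]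
    · intro h' _ hne
      rw [if_neg fun h'' => hne (hu _ h'')]
    · simp
  rw [sum_congr rfl fun σ _ => h1 σ, sum_comm]
  have h2 : ∀ h : Perm (Fin m) × (Fin m → Perm (Fin 2)),
      (∑ σ : Perm (Fin (2 * m)),
        if IsMatchingPerm (σ * pairPerm h) then pfTerm A (σ * pairPerm h) else 0) =
      ∑ σ : Perm (Fin (2 * m)) with IsMatchingPerm σ, pfTerm A σ := by
    intro h
    rw [sum_filter]
    exact Equiv.sum_comp (Equiv.mulRight (pairPerm h))
      fun σ => if IsMatchingPerm σ then pfTerm A σ else 0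
  rw [sum_congr rfl fun h _ => h2 h, sum_const, nsmul_eq_mul]
  congr 1
  simp [Fintype.card_perm]

/-! ### Congruence transformations -/

/-- The function on indices determined by its values on the pairs. -/
def pairFun {m : ℕ} {n : Type*} (g : Fin m → n × n) (i : Fin (2 * m)) : n :=
  let p := (pairEquiv m).symm i
  if p.2 = 0 then (g p.1).1 else (g p.1).2

/-- Expanding all entries of the product leaves, for a fixed choice `g` of index pairs, a signed sum
over σ that is a determinant of selected columns of `B`. The sum over all permutations, unlike the
sum over matchings, permits this. -/
lemma sum_pfTerm_mul_mul_transpose {m : ℕ} {n : Type*} [Fintype n]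
    (B : Matrix (Fin (2 * m)) n ℝ) (A : Matrix n n ℝ) :
    ∑ σ, pfTerm (B * A * B.transpose) σ =
      ∑ g : Fin m → n × n, (∏ l, A (g l).1 (g l).2) * (B.submatrix id (pairFun g)).det := by
  classical
  have h1 : ∀ i j, (B * A * B.transpose) i j = ∑ p : n × n, B i p.1 * B j p.2 * A p.1 p.2 := by
    intro i j
    simp only [Matrix.mul_apply, Matrix.transpose_apply, sum_mul, Fintype.sum_prod_type]
    rw [sum_comm]
    refine sum_congr rfl fun a _ => sum_congr rfl fun b _ => by ring
  have h2 : ∀ σ, pfTerm (B * A * B.transpose) σ = ∑ g : Fin m → n × n,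
      (∏ l, A (g l).1 (g l).2) *
        (((Perm.sign σ : ℤ) : ℝ) * ∏ i, B (σ i) (pairFun g i)) := by
    intro σ
    rw [pfTerm]
    simp_rw [h1]
    rw [prod_univ_sum, mul_sum]
    simp only [Fintype.piFinset_univ]
    refine sum_congr rfl fun g _ => ?_
    rw [prod_mul_distrib, ← Equiv.prod_comp (pairEquiv m), Fintype.prod_prod_type]
    simp only [Fin.prod_univ_two, pairFun, Equiv.symm_apply_apply]
    simp
    ring
  simp_rw [h2]
  rw [sum_comm]
  refine sum_congr rfl fun g _ => ?_
  rw [← mul_sum, Matrix.det_apply']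
  rfl

lemma skew_mul_mul_transpose {m n : Type*} [Fintype n] {A : Matrix n n ℝ}
    (hA : ∀ i j, A j i = -A i j) (B : Matrix m n ℝ) (i j : m) :
    (B * A * B.transpose) j i = -(B * A * B.transpose) i j := by
  have hA' : A.transpose = -A := by
    ext i j; exact hA i j
  have : (B * A * B.transpose).transpose = -(B * A * B.transpose) := by
    rw [Matrix.transpose_mul, Matrix.transpose_mul, Matrix.transpose_transpose, hA']
    simp [Matrix.mul_assoc]
  exact congrFun (congrFun this i) j

/-- The expansion is applied to `B` and to the identity; corresponding summands differ by the factor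
det B, because selecting columns of `B` is multiplication by a selection of columns of 1. -/
theorem pfaffian_mul_mul_transpose {m : ℕ} {A : Matrix (Fin (2 * m)) (Fin (2 * m)) ℝ}
    (hA : ∀ i j, A j i = -A i j) (B : Matrix (Fin (2 * m)) (Fin (2 * m)) ℝ) :
    pfaffian m (B * A * B.transpose) = B.det * pfaffian m A := by
  have hc : (m.factorial * 2 ^ m : ℝ) ≠ 0 := by positivity
  apply mul_left_cancel₀ hc
  rw [← sum_pfTerm (skew_mul_mul_transpose hA B), mul_left_comm, ← sum_pfTerm hA,
    sum_pfTerm_mul_mul_transpose]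
  have := sum_pfTerm_mul_mul_transpose (1 : Matrix (Fin (2 * m)) (Fin (2 * m)) ℝ) A
  rw [Matrix.one_mul, Matrix.transpose_one, Matrix.mul_one] at this
  rw [this, mul_sum]
  refine sum_congr rfl fun g _ => ?_
  rw [mul_left_comm, ← Matrix.det_mul]
  congr 2
  ext i j
  simp [Matrix.mul_apply, Matrix.one_apply]

lemma pfaffian_submatrix_perm {m : ℕ} {A : Matrix (Fin (2 * m)) (Fin (2 * m)) ℝ}
    (hA : ∀ i j, A j i = -A i j) (s : Perm (Fin (2 * m))) :
    pfaffian m (A.submatrix s s) = ((Perm.sign s : ℤ) : ℝ) * pfaffian m A := by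
  have h := pfaffian_mul_mul_transpose hA ((1 : Matrix _ _ ℝ).submatrix s id)
  rw [Matrix.det_permute, Matrix.det_one, mul_one] at h
  rw [← h]
  congr 1
  ext i j
  simp [Matrix.mul_apply, Matrix.one_apply]

/-! ### Expansion along a row with one nonzero entry -/

lemma pairEquiv_first (m : ℕ) :
    pairEquiv (m + 1) (0, 0) = (0 : Fin (2 * m + 2)) ∧
      pairEquiv (m + 1) (0, 1) = (1 : Fin (2 * m + 2)) := by
  constructor
  · ext; simp [pairEquiv]
  · ext
    simp only [pairEquiv, Equiv.trans_apply, finCongr_apply, Fin.val_cast, finProdFinEquiv_apply_val]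
    simp only [Fin.val_zero, Nat.mul_zero, Nat.add_zero]
    exact (Nat.mod_eq_of_lt (by omega)).symm

lemma pairEquiv_succ {m : ℕ} (l : Fin m) (c : Fin 2) :
    pairEquiv (m + 1) (l.succ, c) = ((pairEquiv m (l, c)).succ.succ : Fin (2 * m + 2)) := by
  ext
  simp [pairEquiv]
  ring

/-- Extend a permutation by two fixed points in front. -/
def extendPerm {n : ℕ} (σ : Perm (Fin n)) : Perm (Fin (n + 2)) :=
  Perm.decomposeFin.symm (0, Perm.decomposeFin.symm (0, σ))

lemma extendPerm_zero {n : ℕ} (σ : Perm (Fin n)) : extendPerm σ 0 = 0 := by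
  simp [extendPerm]

lemma extendPerm_one {n : ℕ} (σ : Perm (Fin n)) : extendPerm σ 1 = 1 := by
  simp [extendPerm]

lemma extendPerm_succ {n : ℕ} (σ : Perm (Fin n)) (i : Fin n) :
    extendPerm σ i.succ.succ = (σ i).succ.succ := by
  simp [extendPerm]

lemma sign_extendPerm {n : ℕ} (σ : Perm (Fin n)) : Perm.sign (extendPerm σ) = Perm.sign σ := by
  simp [extendPerm]

lemma exists_extendPerm {n : ℕ} {σ : Perm (Fin (n + 2))} (h0 : σ 0 = 0) (h1 : σ 1 = 1) :
    ∃ σ', extendPerm σ' = σ := by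
  obtain ⟨⟨p, e⟩, rfl⟩ := Perm.decomposeFin.symm.surjective σ
  rw [Perm.decomposeFin_symm_apply_zero] at h0
  subst h0
  obtain ⟨⟨q, e⟩, rfl⟩ := Perm.decomposeFin.symm.surjective e
  rw [Perm.decomposeFin_symm_apply_one, Perm.decomposeFin_symm_apply_zero] at h1
  have : q = 0 := by
    simp at h1
    apply Fin.succ_injective
    simpa using h1
  subst this
  exact ⟨e, rfl⟩

lemma isMatchingPerm_extendPerm {m : ℕ} (σ : Perm (Fin (2 * m))) :
    IsMatchingPerm (m := m + 1) (extendPerm σ) ↔ IsMatchingPerm σ := by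
  unfold IsMatchingPerm
  constructor
  · rintro ⟨h1, h2⟩
    constructor
    · intro l
      have := h1 l.succ
      rw [pairEquiv_succ, pairEquiv_succ, extendPerm_succ, extendPerm_succ] at this
      simpa using this
    · intro l l' hl
      have := h2 (Fin.succ_lt_succ_iff.2 hl)
      simp only [pairEquiv_succ, extendPerm_succ] at this
      simpa using this
  · rintro ⟨h1, h2⟩
    constructor
    · intro l
      refine Fin.cases ?_ (fun l => ?_) l
      · rw [(pairEquiv_first m).1, (pairEquiv_first m).2, extendPerm_zero, extendPerm_one]
        exact Fin.zero_lt_one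
      · rw [pairEquiv_succ, pairEquiv_succ, extendPerm_succ, extendPerm_succ]
        simpa using h1 l
    · intro l l'
      refine Fin.cases ?_ (fun l' => ?_) l'
      · intro h; exact absurd h (Fin.not_lt_zero _)
      refine Fin.cases ?_ (fun l => ?_) l
      · intro _
        simp only [pairEquiv_succ, extendPerm_succ]
        rw [(pairEquiv_first m).1, extendPerm_zero]
        exact Fin.succ_pos _
      · intro h
        simp only [pairEquiv_succ, extendPerm_succ]
        simpa using h2 (Fin.succ_lt_succ_iff.1 h)

lemma IsMatchingPerm.apply_zero {m : ℕ} {σ : Perm (Fin (2 * m + 2))}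
    (h : IsMatchingPerm (m := m + 1) σ) : σ 0 = 0 := by
  obtain ⟨⟨l, c⟩, hi⟩ := (pairEquiv (m + 1)).surjective (σ.symm (0 : Fin (2 * m + 2)))
  have hi' : σ (pairEquiv (m + 1) (l, c)) = (0 : Fin (2 * m + 2)) := by
    rw [hi]; exact σ.apply_symm_apply 0
  have hc : c = 0 ∨ c = 1 := by omega
  rcases hc with rfl | rfl
  · by_cases hl : l = 0
    · subst hl
      rwa [(pairEquiv_first m).1] at hi'
    · have := h.2 (Fin.pos_iff_ne_zero.2 hl)
      simp only [hi'] at this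
      exact absurd this (Fin.not_lt_zero _)
  · have := h.1 l
    rw [hi'] at this
    exact absurd this (Fin.not_lt_zero _)

lemma pfTerm_succ {m : ℕ} (A : Matrix (Fin (2 * m + 2)) (Fin (2 * m + 2)) ℝ)
    (σ : Perm (Fin (2 * m + 2))) :
    pfTerm (m := m + 1) A σ = ((Perm.sign σ : ℤ) : ℝ) * (A (σ 0) (σ 1) *
      ∏ l : Fin m, A (σ (pairEquiv m (l, 0)).succ.succ) (σ (pairEquiv m (l, 1)).succ.succ)) := by
  rw [pfTerm, Fin.prod_univ_succ]
  simp only [pairEquiv_succ]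
  rw [(pairEquiv_first m).1, (pairEquiv_first m).2]

/-- A Pfaffian whose first row has only one nonzero entry. -/
theorem pfaffian_succ_of_row {m : ℕ} (A : Matrix (Fin (2 * m + 2)) (Fin (2 * m + 2)) ℝ)
    (h : ∀ j, j ≠ 1 → A 0 j = 0) :
    pfaffian (m + 1) A =
      A 0 1 * pfaffian m (A.submatrix (fun i => i.succ.succ) fun i => i.succ.succ) := by
  classical
  rw [pfaffian_eq_sum_matching, pfaffian_eq_sum_matching, mul_sum]
  symm
  apply Finset.sum_of_injOn (extendPerm (n := 2 * m))
  · intro σ _ σ' _ hσ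
    have := Perm.decomposeFin.symm.injective hσ
    exact (Prod.mk.inj (Perm.decomposeFin.symm.injective (Prod.mk.inj this).2)).2
  · intro σ hσ
    simp only [coe_filter, mem_univ, true_and, Set.mem_ofPred_eq] at hσ ⊢
    exact (isMatchingPerm_extendPerm σ).2 hσ
  -- A matching that is not an extension still fixes 0 but pairs it with an index other than 1, so
  -- its term contains a vanishing entry of the first row.
  · intro σ hσ hn
    simp only [mem_filter, mem_univ, true_and] at hσ
    have h0 := hσ.apply_zero
    have h1 : σ (1 : Fin (2 * m + 2)) ≠ (1 : Fin (2 * m + 2)) := by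
      intro h1
      obtain ⟨σ', rfl⟩ := exists_extendPerm h0 h1
      exact hn ⟨σ', by simpa using (isMatchingPerm_extendPerm σ').1 hσ, rfl⟩
    rw [pfTerm_succ, h0, h _ h1]
    simp
  · intro σ _
    rw [pfTerm_succ, extendPerm_zero, extendPerm_one, sign_extendPerm, pfTerm]
    simp only [extendPerm_succ, Matrix.submatrix_apply]
    ring

lemma pfaffian_zero (A : Matrix (Fin (2 * 0)) (Fin (2 * 0)) ℝ) : pfaffian 0 A = 1 := by
  classical
  have : IsEmpty (Fin (2 * 0)) := Fin.isEmpty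
  rw [pfaffian_eq_sum_matching, sum_eq_single 1]
  · simp [pfTerm]
  · intro σ _ h
    exact absurd (Subsingleton.elim _ _) h
  · intro h
    exact absurd (by simp [IsMatchingPerm, StrictMono]) h

/-! ### Elimination -/

/-- The indices `0, 1` split off in front. -/
def frontEquiv (n : ℕ) : Fin 2 ⊕ Fin n ≃ Fin (n + 2) :=
  finSumFinEquiv.trans (finCongr (Nat.add_comm 2 n))

lemma frontEquiv_inl (n : ℕ) :
    frontEquiv n (Sum.inl 0) = 0 ∧ frontEquiv n (Sum.inl 1) = 1 := by
  constructor <;> (ext; simp [frontEquiv])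

lemma frontEquiv_inr {n : ℕ} (i : Fin n) : frontEquiv n (Sum.inr i) = i.succ.succ := by
  ext; simp [frontEquiv]

/-- The Schur complement of the block with indices `0, 1` in a skew-symmetric matrix. -/
def skewSchur {n : ℕ} (A : Matrix (Fin (n + 2)) (Fin (n + 2)) ℝ) : Matrix (Fin n) (Fin n) ℝ :=
  Matrix.of fun i j => A i.succ.succ j.succ.succ -
    (A 0 i.succ.succ * A 1 j.succ.succ - A 1 i.succ.succ * A 0 j.succ.succ) / A 0 1

/-- The elimination matrix for the block with indices `0, 1`. -/
def elimMatrix {n : ℕ} (A : Matrix (Fin (n + 2)) (Fin (n + 2)) ℝ) :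
    Matrix (Fin (n + 2)) (Fin (n + 2)) ℝ :=
  (Matrix.fromBlocks 1 0
    (Matrix.of fun (i : Fin n) (c : Fin 2) =>
      if c = 0 then -A 1 i.succ.succ / A 0 1 else A 0 i.succ.succ / A 0 1) 1).submatrix
    (frontEquiv n).symm (frontEquiv n).symm

/-- The matrix after elimination. -/
def elimResult {n : ℕ} (A : Matrix (Fin (n + 2)) (Fin (n + 2)) ℝ) :
    Matrix (Fin (n + 2)) (Fin (n + 2)) ℝ :=
  (Matrix.fromBlocks (Matrix.of ![![0, A 0 1], ![-A 0 1, 0]]) 0 0 (skewSchur A)).submatrix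
    (frontEquiv n).symm (frontEquiv n).symm

lemma det_elimMatrix {n : ℕ} (A : Matrix (Fin (n + 2)) (Fin (n + 2)) ℝ) :
    (elimMatrix A).det = 1 := by
  rw [elimMatrix, Matrix.det_submatrix_equiv_self, Matrix.det_fromBlocks_zero₁₂]
  simp

lemma skew_diag {n : Type*} {A : Matrix n n ℝ} (hA : ∀ i j, A j i = -A i j) (i : n) :
    A i i = 0 := by
  have := hA i i
  linarith

lemma skewSchur_skew {n : ℕ} {A : Matrix (Fin (n + 2)) (Fin (n + 2)) ℝ}
    (hA : ∀ i j, A j i = -A i j) (i j : Fin n) : skewSchur A j i = -skewSchur A i j := by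
  simp only [skewSchur, Matrix.of_apply]
  rw [hA i.succ.succ j.succ.succ]
  ring

/-- The block L D Lᵀ factorisation with det L = 1. It reduces Pfaffian and determinant to the same
Schur complement, which drives the induction in `pfaffian_sq`. -/
lemma elimMatrix_mul {n : ℕ} {A : Matrix (Fin (n + 2)) (Fin (n + 2)) ℝ}
    (hA : ∀ i j, A j i = -A i j) (h : A 0 1 ≠ 0) :
    elimMatrix A * elimResult A * (elimMatrix A).transpose = A := by
  rw [elimMatrix, elimResult, Matrix.submatrix_mul_equiv, Matrix.transpose_submatrix,
    Matrix.submatrix_mul_equiv, Matrix.fromBlocks_multiply, Matrix.fromBlocks_transpose,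
    Matrix.fromBlocks_multiply]
  have h00 := skew_diag hA 0
  have h11 := skew_diag hA 1
  have h10 := hA 0 1
  ext i j
  obtain ⟨i, rfl⟩ := (frontEquiv n).surjective i
  obtain ⟨j, rfl⟩ := (frontEquiv n).surjective j
  simp only [Matrix.submatrix_apply, Equiv.symm_apply_apply]
  rcases i with i | i <;> rcases j with j | j
  · fin_cases i <;> fin_cases j <;>
      simp [frontEquiv_inl, h00, h11, h10]
  · fin_cases i
    · simp [frontEquiv_inl, frontEquiv_inr, Matrix.vecMul, dotProduct, Fin.sum_univ_two]
      field_simp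
    · simp [frontEquiv_inl, frontEquiv_inr, Matrix.vecMul, dotProduct, Fin.sum_univ_two]
      field_simp
  · fin_cases j
    · simp [frontEquiv_inl, frontEquiv_inr, Matrix.mul_apply, Fin.sum_univ_two, hA 0 i.succ.succ]
      field_simp
    · simp [frontEquiv_inl, frontEquiv_inr, Matrix.mul_apply, Fin.sum_univ_two, hA 1 i.succ.succ]
      field_simp
  · simp [frontEquiv_inr, Matrix.mul_apply, Fin.sum_univ_two, skewSchur]
    field_simp
    ring

lemma elimResult_skew {n : ℕ} {A : Matrix (Fin (n + 2)) (Fin (n + 2)) ℝ}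
    (hA : ∀ i j, A j i = -A i j) (i j : Fin (n + 2)) :
    elimResult A j i = -elimResult A i j := by
  obtain ⟨i, rfl⟩ := (frontEquiv n).surjective i
  obtain ⟨j, rfl⟩ := (frontEquiv n).surjective j
  simp only [elimResult, Matrix.submatrix_apply, Equiv.symm_apply_apply]
  rcases i with i | i <;> rcases j with j | j
  · fin_cases i <;> fin_cases j <;> simp
  · simp
  · simp
  · simpa using skewSchur_skew hA i j

lemma elimResult_zero {n : ℕ} (A : Matrix (Fin (n + 2)) (Fin (n + 2)) ℝ) :
    elimResult A 0 1 = A 0 1 ∧ ∀ j, j ≠ 1 → elimResult A 0 j = 0 := by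
  have e0 : (frontEquiv n).symm 0 = Sum.inl 0 := by
    rw [Equiv.symm_apply_eq, (frontEquiv_inl _).1]
  have e1 : (frontEquiv n).symm 1 = Sum.inl 1 := by
    rw [Equiv.symm_apply_eq, (frontEquiv_inl _).2]
  refine ⟨by simp [elimResult, e0, e1], fun j hj => ?_⟩
  obtain ⟨j, rfl⟩ := (frontEquiv n).surjective j
  simp only [elimResult, Matrix.submatrix_apply, Equiv.symm_apply_apply, e0]
  rcases j with j | j
  · fin_cases j
    · simp
    · exact absurd (frontEquiv_inl _).2 hj
  · simp

lemma elimResult_succ {n : ℕ} (A : Matrix (Fin (n + 2)) (Fin (n + 2)) ℝ) :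
    (elimResult A).submatrix (fun i => i.succ.succ) (fun i => i.succ.succ) = skewSchur A := by
  have e2 : ∀ i, (frontEquiv n).symm i.succ.succ = Sum.inr i := by
    intro i
    rw [Equiv.symm_apply_eq, frontEquiv_inr]
  ext i j
  simp [elimResult, e2]

theorem pfaffian_elim {m : ℕ} {A : Matrix (Fin (2 * m + 2)) (Fin (2 * m + 2)) ℝ}
    (hA : ∀ i j, A j i = -A i j) (h : A 0 1 ≠ 0) :
    pfaffian (m + 1) A = A 0 1 * pfaffian m (skewSchur A) := by
  have h1 := pfaffian_mul_mul_transpose (m := m + 1) (elimResult_skew hA) (elimMatrix A)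
  rw [elimMatrix_mul hA h, det_elimMatrix, one_mul] at h1
  rw [h1, pfaffian_succ_of_row _ (elimResult_zero A).2, (elimResult_zero A).1, elimResult_succ]

theorem det_elim {n : ℕ} {A : Matrix (Fin (n + 2)) (Fin (n + 2)) ℝ}
    (hA : ∀ i j, A j i = -A i j) (h : A 0 1 ≠ 0) :
    A.det = A 0 1 ^ 2 * (skewSchur A).det := by
  conv_lhs => rw [← elimMatrix_mul hA h]
  rw [Matrix.det_mul, Matrix.det_mul, Matrix.det_transpose, det_elimMatrix, elimResult,
    Matrix.det_submatrix_equiv_self, Matrix.det_fromBlocks_zero₂₁, Matrix.det_fin_two]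
  simp [sq]

/-- The square of the Pfaffian is the determinant. -/
theorem pfaffian_sq {m : ℕ} {A : Matrix (Fin (2 * m)) (Fin (2 * m)) ℝ}
    (hA : ∀ i j, A j i = -A i j) : pfaffian m A ^ 2 = A.det := by
  induction m with
  | zero => rw [pfaffian_zero, one_pow]; exact Matrix.det_fin_zero.symm
  | succ m ih =>
    change Matrix (Fin (2 * m + 2)) (Fin (2 * m + 2)) ℝ at A
    by_cases hz : ∃ j, A 0 j ≠ 0
    · obtain ⟨j, hj⟩ := hz
      have hj0 : j ≠ 0 := by
        rintro rfl
        exact hj (skew_diag hA 0)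
      -- The swap brings a nonzero entry of the first row to position (0, 1), as elimination
      -- requires; its sign disappears on squaring.
      set s : Perm (Fin (2 * m + 2)) := swap 1 j with hs
      have hB : ∀ i k, (A.submatrix s s) k i = -(A.submatrix s s) i k := fun i k => hA _ _
      have h01 : (A.submatrix s s) 0 1 ≠ 0 := by
        have : s 0 = 0 := swap_apply_of_ne_of_ne (by simp) hj0.symm
        have hs1 : s 1 = j := swap_apply_left _ _
        rw [Matrix.submatrix_apply, this, hs1]
        exact hj
      have h1 := pfaffian_submatrix_perm (m := m + 1) hA s
      have h2 : pfaffian (m + 1) (A.submatrix s s) ^ 2 = pfaffian (m + 1) A ^ 2 := by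
        rw [h1, mul_pow, ← Int.cast_pow, ← Units.val_pow_eq_pow_val, Int.units_sq]
        simp
      rw [← h2, pfaffian_elim hB h01, mul_pow, ih (skewSchur_skew hB),
        ← Matrix.det_submatrix_equiv_self s A]
      exact (det_elim hB h01).symm
    · push Not at hz
      rw [pfaffian_succ_of_row A fun j _ => hz j, hz, zero_mul]
      rw [Matrix.det_eq_zero_of_row_eq_zero (0 : Fin (2 * m + 2)) hz]
      simp

/-! ### The Pfaffian of Schur -/

/-- The matrix `(x_j - x_i) / (x_i + x_j)`. -/
def schurMatrix {n : Type*} (x : n → ℝ) : Matrix n n ℝ :=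
  Matrix.of fun i j => (x j - x i) / (x i + x j)

lemma schurMatrix_skew {n : Type*} (x : n → ℝ) (i j : n) :
    schurMatrix x j i = -schurMatrix x i j := by
  simp only [schurMatrix, Matrix.of_apply]
  rw [add_comm (x j), ← neg_div, neg_sub]

lemma diagonal_mul_mul_diagonal_apply {n : Type*} [Fintype n] [DecidableEq n] (d : n → ℝ)
    (A : Matrix n n ℝ) (i j : n) :
    (Matrix.diagonal d * A * (Matrix.diagonal d).transpose) i j = d i * A i j * d j := by
  rw [Matrix.diagonal_transpose, Matrix.mul_diagonal, Matrix.diagonal_mul]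

lemma prod_Ioi_succ_succ {n : ℕ} (g : Fin (n + 2) → Fin (n + 2) → ℝ) :
    ∏ i, ∏ j ∈ Ioi i, g i j = g 0 1 *
      ((∏ i : Fin n, g 0 i.succ.succ * g 1 i.succ.succ) *
        ∏ i : Fin n, ∏ j ∈ Ioi i, g i.succ.succ j.succ.succ) := by
  rw [Fin.prod_univ_succ, Fin.prod_univ_succ]
  simp only [Fin.prod_Ioi_succ, Fin.prod_Ioi_zero]
  rw [Fin.prod_univ_succ, Finset.prod_mul_distrib]
  simp only [Fin.succ_zero_eq_one]
  ring

/-- The Schur complement of the kernel (y-x)/(x+y) is the same kernel on the remaining nodes,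
congruent by the diagonal matrix with entries a_{0i} a_{1i}. These are exactly the factors of the
product that involve the nodes 0 and 1, so induction applies. -/
theorem pfaffian_schurMatrix {m : ℕ} (x : Fin (2 * m) → ℝ) (hx : Function.Injective x)
    (hs : ∀ i j, i ≠ j → x i + x j ≠ 0) :
    pfaffian m (schurMatrix x) = ∏ i, ∏ j ∈ Ioi i, (x j - x i) / (x i + x j) := by
  induction m with
  | zero =>
    have : IsEmpty (Fin (2 * 0)) := Fin.isEmpty
    rw [pfaffian_zero, Finset.univ_eq_empty, prod_empty]
  | succ m ih =>
    change Fin (2 * m + 2) → ℝ at x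
    change ∀ i j : Fin (2 * m + 2), _ at hs
    change _ = ∏ i : Fin (2 * m + 2), _
    have h01 : (0 : Fin (2 * m + 2)) ≠ 1 := by simp
    have hd01 : x 1 - x 0 ≠ 0 := sub_ne_zero.2 (hx.ne h01.symm)
    have hne : schurMatrix x 0 1 ≠ 0 := div_ne_zero hd01 (hs _ _ h01)
    rw [pfaffian_elim (schurMatrix_skew x) hne]
    set f : Fin (2 * m) → ℝ := fun i => schurMatrix x 0 i.succ.succ * schurMatrix x 1 i.succ.succ
    have key : skewSchur (schurMatrix x) =
        Matrix.diagonal f * schurMatrix (fun i : Fin (2 * m) => x i.succ.succ) *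
          (Matrix.diagonal f).transpose := by
      ext i j
      rw [diagonal_mul_mul_diagonal_apply]
      rcases eq_or_ne i j with rfl | hij
      · simp [skewSchur, schurMatrix]
        left; ring
      · have h1 := hs 0 i.succ.succ (by simp [Fin.ext_iff])
        have h2 := hs 0 j.succ.succ (by simp [Fin.ext_iff])
        have h3 := hs 1 i.succ.succ (by simp [Fin.ext_iff])
        have h4 := hs 1 j.succ.succ (by simp [Fin.ext_iff])
        have h5 := hs i.succ.succ j.succ.succ (by simpa [Fin.ext_iff] using hij)
        have h6 := hs 0 1 h01
        simp only [skewSchur, schurMatrix, Matrix.of_apply, f]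
        generalize x 0 = p at *
        generalize x 1 = q at *
        generalize x i.succ.succ = r at *
        generalize x j.succ.succ = s at *
        field_simp
        ring
    rw [key, pfaffian_mul_mul_transpose (schurMatrix_skew _), Matrix.det_diagonal,
      ih (fun i => x i.succ.succ) (hx.comp ((Fin.succ_injective _).comp (Fin.succ_injective _)))
        fun i j hij => hs _ _ (by simpa [Fin.ext_iff] using hij)]
    exact (prod_Ioi_succ_succ fun i j => (x j - x i) / (x i + x j)).symm

/-! ### Bordered matrices and the function `τ` -/

/-- The skew-symmetric matrix `J` bordered by the row `(0, β)` and the column `(0, -β)`. -/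
def border {n : ℕ} (β : Fin n → ℝ) (J : Matrix (Fin n) (Fin n) ℝ) :
    Matrix (Fin (n + 1)) (Fin (n + 1)) ℝ :=
  Matrix.of (Fin.cons (Fin.cons 0 β) fun i => Fin.cons (-β i) (J i))

section border
variable {n : ℕ} (β : Fin n → ℝ) (J : Matrix (Fin n) (Fin n) ℝ)

@[simp] lemma border_zero_zero : border β J 0 0 = 0 := rfl
@[simp] lemma border_zero_succ (j : Fin n) : border β J 0 j.succ = β j := rfl
@[simp] lemma border_succ_zero (i : Fin n) : border β J i.succ 0 = -β i := rfl
@[simp] lemma border_succ_succ (i j : Fin n) : border β J i.succ j.succ = J i j := rfl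

variable {β J} in
lemma border_skew (hJ : ∀ i j, J j i = -J i j) (i j : Fin (n + 1)) :
    border β J j i = -border β J i j := by
  refine Fin.cases ?_ (fun i => ?_) i <;> refine Fin.cases ?_ (fun j => ?_) j 
  · simp
  · simp
  · simp
  · exact hJ i j

/-- The matrix `β βᵀ - J`. -/
def rankOneSub : Matrix (Fin n) (Fin n) ℝ := Matrix.of fun i j => β i * β j - J i j

-- With corner 1 instead of 0, the bordered matrix has Schur complement J + ββᵀ, the transpose of
-- ββᵀ - J. Changing the corner from 1 to 0 removes det J from the expansion along the first row.
variable {β J} in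
lemma det_rankOneSub (hJ : ∀ i j, J j i = -J i j) :
    (rankOneSub β J).det = J.det + (border β J).det := by
  have h1 : (rankOneSub β J).det =
      (Matrix.fromBlocks (1 : Matrix (Fin 1) (Fin 1) ℝ) (Matrix.of fun _ j => β j)
        (Matrix.of fun i _ => -β i) J).det := by
    rw [Matrix.det_fromBlocks_one₁₁, ← Matrix.det_transpose]
    congr 1
    ext i j
    simp [rankOneSub, Matrix.mul_apply, hJ i j]
    ring
  set e : Fin (n + 1) ≃ Fin 1 ⊕ Fin n := (finSumFinEquiv.trans (finCongr (Nat.add_comm 1 n))).symm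
  have e0 : e 0 = Sum.inl 0 := by
    rw [Equiv.symm_apply_eq]; ext; simp
  have es : ∀ i : Fin n, e i.succ = Sum.inr i := by
    intro i
    rw [Equiv.symm_apply_eq]; ext; simp
  rw [h1, ← Matrix.det_submatrix_equiv_self e, Matrix.det_succ_row_zero,
    Matrix.det_succ_row_zero (border β J), Fin.sum_univ_succ, Fin.sum_univ_succ]
  congr 1
  · simp only [Matrix.submatrix_apply, e0, Matrix.submatrix_submatrix]
    simp
    congr 1
    ext i j
    simp [es]
  · simp only [border_zero_zero, mul_zero, zero_mul, zero_add]
    refine Finset.sum_congr rfl fun j _ => ?_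
    congr 1
    · simp [e0, es]
    · congr 1
      ext i k
      simp only [Matrix.submatrix_apply, es]
      have : ∀ a, Matrix.fromBlocks (1 : Matrix (Fin 1) (Fin 1) ℝ) (Matrix.of fun _ j => β j)
        (Matrix.of fun i _ => -β i) J (Sum.inr i) (e a) = border β J i.succ a := by
        intro a
        refine Fin.cases ?_ (fun a => ?_) a
        · simp [e0]
        · simp [es]
      exact this _

end border

lemma det_skew_odd {n : ℕ} (hn : Odd n) {A : Matrix (Fin n) (Fin n) ℝ}
    (hA : ∀ i j, A j i = -A i j) : A.det = 0 := by
  have h : A.transpose = -A := by ext i j; exact hA i j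
  have h1 := congrArg Matrix.det h
  rw [Matrix.det_transpose, Matrix.det_neg, Fintype.card_fin, hn.neg_one_pow] at h1
  linarith

/-- The Pfaffian of `J` (even size) or of the bordered matrix (odd size). -/
def tauAux {k : ℕ} (β : Fin k → ℝ) (J : Matrix (Fin k) (Fin k) ℝ) : ℝ :=
  if h : Even k then
    pfaffian (k / 2) (J.submatrix (Fin.cast (Nat.two_mul_div_two_of_even h))
      (Fin.cast (Nat.two_mul_div_two_of_even h)))
  else
    pfaffian ((k + 1) / 2)
      ((border β J).submatrix
        (Fin.cast (Nat.two_mul_div_two_of_even (Nat.even_add_one.2 h)))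
        (Fin.cast (Nat.two_mul_div_two_of_even (Nat.even_add_one.2 h))))

lemma pfaffian_cast {m m' : ℕ} (hm : m' = m) (h : 2 * m' = 2 * m)
    (A : Matrix (Fin (2 * m)) (Fin (2 * m)) ℝ) :
    pfaffian m' (A.submatrix (Fin.cast h) (Fin.cast h)) = pfaffian m A := by
  subst hm; rfl

lemma tauAux_even {m : ℕ} (β : Fin (2 * m) → ℝ) (J : Matrix (Fin (2 * m)) (Fin (2 * m)) ℝ) :
    tauAux β J = pfaffian m J := by
  rw [tauAux, dif_pos (even_two_mul m)]
  exact pfaffian_cast (by omega) _ _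

lemma tauAux_odd {m : ℕ} (β : Fin (2 * m + 1) → ℝ)
    (J : Matrix (Fin (2 * m + 1)) (Fin (2 * m + 1)) ℝ) :
    tauAux β J = pfaffian (m + 1) (border β J) := by
  rw [tauAux, dif_neg (by simp)]
  exact pfaffian_cast (m := m + 1) (by omega) _ (border β J)

/-- `det (β βᵀ - J) = τ²`. -/
theorem det_rankOneSub_eq_sq {k : ℕ} (β : Fin k → ℝ) {J : Matrix (Fin k) (Fin k) ℝ}
    (hJ : ∀ i j, J j i = -J i j) : (rankOneSub β J).det = tauAux β J ^ 2 := by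
  rw [det_rankOneSub hJ]
  -- `J` and its bordered matrix have sizes of opposite parity: the odd one has determinant 0, the
  -- even one contributes its squared Pfaffian.
  obtain ⟨m, rfl | rfl⟩ := k.even_or_odd'
  · rw [tauAux_even, pfaffian_sq hJ, det_skew_odd (odd_two_mul_add_one m) (border_skew hJ),
      add_zero]
  · rw [tauAux_odd, pfaffian_sq (m := m + 1) (border_skew hJ),
      det_skew_odd (odd_two_mul_add_one m) hJ, zero_add]

/-- `τ` is alternating. -/
theorem tauAux_perm {k : ℕ} (β : Fin k → ℝ) {J : Matrix (Fin k) (Fin k) ℝ}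
    (hJ : ∀ i j, J j i = -J i j) (s : Perm (Fin k)) :
    tauAux (β ∘ s) (J.submatrix s s) = ((Perm.sign s : ℤ) : ℝ) * tauAux β J := by
  obtain ⟨m, rfl | rfl⟩ := k.even_or_odd'
  · rw [tauAux_even, tauAux_even, pfaffian_submatrix_perm hJ]
  · rw [tauAux_odd, tauAux_odd]
    have h := pfaffian_submatrix_perm (m := m + 1) (border_skew (β := β) hJ)
      (Perm.decomposeFin.symm (0, s))
    have h2 : ((Perm.sign (Perm.decomposeFin.symm (0, s)) : ℤ) : ℝ) =
        ((Perm.sign s : ℤ) : ℝ) := by simp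
    rw [← h2]
    refine Eq.trans ?_ h
    congr 1
    ext i j
    refine Fin.cases ?_ (fun i => ?_) i <;> refine Fin.cases ?_ (fun j => ?_) j <;> simp

/-- The Pfaffian is linear in each row (and the corresponding column). -/
theorem pfaffian_add {m : ℕ} (r : Fin (2 * m)) {A B C : Matrix (Fin (2 * m)) (Fin (2 * m)) ℝ}
    (hB : ∀ i j, i ≠ r → j ≠ r → A i j = B i j) (hC : ∀ i j, i ≠ r → j ≠ r → A i j = C i j)
    (hr : ∀ j, A r j = B r j + C r j) (hr' : ∀ j, A j r = B j r + C j r) :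
    pfaffian m A = pfaffian m B + pfaffian m C := by
  classical
  rw [pfaffian_eq_sum_matching, pfaffian_eq_sum_matching, pfaffian_eq_sum_matching,
    ← sum_add_distrib]
  refine sum_congr rfl fun σ _ => ?_
  -- The index `r` lies in exactly one pair of the matching, so each term has exactly one factor
  -- from row or column `r`.
  obtain ⟨⟨l, c⟩, hl⟩ := (pairEquiv m).surjective (σ.symm r)
  have hσ : σ (pairEquiv m (l, c)) = r := by rw [hl, Equiv.apply_symm_apply]
  have hother : ∀ l', l' ≠ l → ∀ c', σ (pairEquiv m (l', c')) ≠ r := by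
    intro l' hl' c' h
    rw [← hσ] at h
    have := (pairEquiv m).injective (σ.injective h)
    exact hl' (Prod.mk.inj this).1
  simp only [pfTerm]
  rw [← mul_add, ← mul_prod_erase univ _ (mem_univ l), ← mul_prod_erase univ _ (mem_univ l),
    ← mul_prod_erase univ _ (mem_univ l)]
  rw [prod_congr (g := fun l => A (σ (pairEquiv m (l, 0))) (σ (pairEquiv m (l, 1)))) rfl
      fun l' hl' => (hB _ _ (hother l' (ne_of_mem_erase hl') 0)
        (hother l' (ne_of_mem_erase hl') 1)).symm,
    prod_congr (f := fun l => C (σ (pairEquiv m (l, 0))) (σ (pairEquiv m (l, 1))))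
      (g := fun l => A (σ (pairEquiv m (l, 0))) (σ (pairEquiv m (l, 1)))) rfl
      fun l' hl' => (hC _ _ (hother l' (ne_of_mem_erase hl') 0)
        (hother l' (ne_of_mem_erase hl') 1)).symm, ← add_mul]
  congr 2
  have hc : c = 0 ∨ c = 1 := by omega
  rcases hc with rfl | rfl
  · rw [hσ, hr]
  · rw [hσ, hr']

/-- Two equal border rows collapse. -/
lemma pfaffian_border_border {m : ℕ} (β : Fin (2 * m) → ℝ)
    {J : Matrix (Fin (2 * m)) (Fin (2 * m)) ℝ} (hJ : ∀ i j, J j i = -J i j) :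
    pfaffian (m + 1) (border (Fin.cons 1 β : Fin (2 * m + 1) → ℝ) (border β J)) =
      pfaffian m J := by
  set A : Matrix (Fin (2 * m + 2)) (Fin (2 * m + 2)) ℝ := border (Fin.cons 1 β) (border β J)
    with hA
  have hAs : ∀ i j, A j i = -A i j := border_skew (border_skew hJ)
  -- Subtracting row and column 1 from row and column 0 leaves 1 at position (0, 1) as the only
  -- nonzero entry of the first row.
  set B : Matrix (Fin (2 * m + 2)) (Fin (2 * m + 2)) ℝ := Matrix.transvection 0 1 (-1)
  have hdet : B.det = 1 := Matrix.det_transvection_of_ne _ _ (by simp) _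
  have h := pfaffian_mul_mul_transpose (m := m + 1) hAs B
  rw [hdet, one_mul] at h
  have hT : B.transpose = Matrix.transvection 1 0 (-1) := by
    simp [B, Matrix.transvection]
  have hA1 : A 0 1 = 1 := rfl
  have hA11 : A 1 1 = 0 := skew_diag hAs 1
  have hA00 : A 0 0 = 0 := skew_diag hAs 0
  have hA10 : A 1 0 = -1 := rfl
  have hAj : ∀ j : Fin (2 * m), A 0 j.succ.succ = A 1 j.succ.succ := fun j => rfl
  rw [← h, pfaffian_succ_of_row, hT]
  · rw [Matrix.mul_transvection_apply_of_ne _ _ _ _ (by simp), Matrix.transvection_mul_apply_same,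
      hA1, hA11]
    simp only [mul_zero, add_zero, one_mul]
    congr 1
    ext i j
    rw [Matrix.submatrix_apply, Matrix.mul_transvection_apply_of_ne _ _ _ _ (by simp [Fin.ext_iff]),
      Matrix.transvection_mul_apply_of_ne _ _ _ _ (by simp [Fin.ext_iff])]
    rfl
  · intro j
    rw [hT]
    refine Fin.cases ?_ (fun j => Fin.cases ?_ (fun j => ?_) j) j
    · intro _
      rw [Matrix.mul_transvection_apply_same, Matrix.transvection_mul_apply_same,
        Matrix.transvection_mul_apply_same, hA00, hA10, hA1, hA11]
      norm_num
    · intro h; exact absurd rfl h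
    · intro _
      rw [Matrix.mul_transvection_apply_of_ne _ _ _ _ (by simp [Fin.ext_iff]),
        Matrix.transvection_mul_apply_same, hAj]
      ring

/-- The determinant of `β βᵀ - J` with its first column replaced by `β`. -/
theorem det_updateCol_rankOneSub {k : ℕ} (β : Fin (k + 1) → ℝ)
    {J : Matrix (Fin (k + 1)) (Fin (k + 1)) ℝ} (hJ : ∀ i j, J j i = -J i j) :
    ((rankOneSub β J).updateCol 0 β).det =
      tauAux β J * tauAux (fun i : Fin k => β i.succ) (J.submatrix Fin.succ Fin.succ) := by
  set β' : Fin k → ℝ := fun i => β i.succ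
  set J' := J.submatrix (Fin.succ : Fin k → _) Fin.succ
  have hJ' : ∀ i j, J' j i = -J' i j := fun i j => hJ _ _
  have hJ0 := skew_diag hJ 0
  -- Polarisation: β₀ is raised by 1 and β' is added to the first row of `J` (with the skew change
  -- in the first column). Then ββᵀ - J changes only in its first column, by 2β + e₀, while τ
  -- becomes τ(β, J) + τ(β', J'). Comparing det = τ² before and after isolates the cross term.
  set βs : Fin (k + 1) → ℝ := Fin.cons (β 0 + 1) β'
  set Js : Matrix (Fin (k + 1)) (Fin (k + 1)) ℝ := border (fun j => J 0 j.succ + β' j) J'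
  have hJs : ∀ i j, Js j i = -Js i j := border_skew hJ'
  -- Linearity of the Pfaffian in the modified row. In the second summand `J'` is bordered twice for
  -- even `k`, where the two borders collapse, and once for odd `k`.
  have hτ : tauAux βs Js = tauAux β J + tauAux β' J' := by
    obtain ⟨m, rfl | rfl⟩ := k.even_or_odd'
    · rw [tauAux_odd, tauAux_odd, tauAux_even, ← pfaffian_border_border β' hJ']
      refine pfaffian_add (m := m + 1) (1 : Fin (2 * m + 2)) ?_ ?_ ?_ ?_
      · intro i j
        refine Fin.cases ?_ (fun i => Fin.cases ?_ (fun i => ?_) i) i <;>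
          refine Fin.cases ?_ (fun j => Fin.cases ?_ (fun j => ?_) j) j <;>
          intro hi hj <;> first | exact absurd rfl hi | exact absurd rfl hj | rfl
      · intro i j
        refine Fin.cases ?_ (fun i => Fin.cases ?_ (fun i => ?_) i) i <;>
          refine Fin.cases ?_ (fun j => Fin.cases ?_ (fun j => ?_) j) j <;>
          intro hi hj <;> first | exact absurd rfl hi | exact absurd rfl hj | rfl
      · intro j
        refine Fin.cases ?_ (fun j => Fin.cases ?_ (fun j => ?_) j) j
        · change -(β 0 + 1) = -β 0 + -1
          ring
        · change 0 = J 0 0 + 0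
          rw [hJ0, add_zero]
        · rfl
      · intro j
        refine Fin.cases ?_ (fun j => Fin.cases ?_ (fun j => ?_) j) j
        · rfl
        · change 0 = J 0 0 + 0
          rw [hJ0, add_zero]
        · change -(J 0 j.succ + β' j) = J j.succ 0 + -β' j
          rw [hJ 0 j.succ]
          ring
    · rw [tauAux_even (m := m + 1) βs Js, tauAux_even (m := m + 1) β J, tauAux_odd]
      refine pfaffian_add (m := m + 1) (0 : Fin (2 * m + 2)) ?_ ?_ ?_ ?_
      · intro i j
        refine Fin.cases ?_ (fun i => ?_) i <;> refine Fin.cases ?_ (fun j => ?_) j <;>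
          intro hi hj <;> first | exact absurd rfl hi | exact absurd rfl hj | rfl
      · intro i j
        refine Fin.cases ?_ (fun i => ?_) i <;> refine Fin.cases ?_ (fun j => ?_) j <;>
          intro hi hj <;> first | exact absurd rfl hi | exact absurd rfl hj | rfl
      · intro j
        refine Fin.cases ?_ (fun j => ?_) j
        · change 0 = J 0 0 + 0
          rw [hJ0, add_zero]
        · rfl
      · intro j
        refine Fin.cases ?_ (fun j => ?_) j
        · change 0 = J 0 0 + 0
          rw [hJ0, add_zero]
        · change -(J 0 j.succ + β' j) = J j.succ 0 + -β' j
          rw [hJ 0 j.succ]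
          ring
  have hdet : (rankOneSub βs Js).det = (rankOneSub β J).det +
      2 * ((rankOneSub β J).updateCol 0 β).det + (rankOneSub β' J').det := by
    have h1 : rankOneSub βs Js = (rankOneSub β J).updateCol 0
        ((fun i => rankOneSub β J i 0) + (2 : ℝ) • β + Pi.single 0 1) := by
      ext i j
      refine Fin.cases ?_ (fun i => ?_) i <;> refine Fin.cases ?_ (fun j => ?_) j
      · simp [rankOneSub, βs, Js, hJ0]
        ring
      · simp [rankOneSub, βs, Js, β']
        ring
      · simp [rankOneSub, βs, Js, β', hJ 0 i.succ]
        ring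
      · simp [rankOneSub, βs, Js, β', J']
    rw [h1, Matrix.det_updateCol_add, Matrix.det_updateCol_add, Matrix.det_updateCol_smul,
      Matrix.updateCol_eq_self]
    congr 1
    rw [Matrix.det_succ_column_zero, Fin.sum_univ_succ, Finset.sum_eq_zero]
    · simp
      congr 1
    · intro i _
      simp
  rw [det_rankOneSub_eq_sq _ hJs, det_rankOneSub_eq_sq _ hJ, det_rankOneSub_eq_sq _ hJ', hτ] at hdet
  linarith

/-! ### The Desnanot–Jacobi identity -/

/-- The first and the last index split off in front. -/
def cornerEquiv (n : ℕ) : Fin 2 ⊕ Fin n ≃ Fin (n + 2) :=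
  Equiv.ofBijective (Sum.elim ![0, Fin.last (n + 1)] fun i => i.succ.castSucc) <| by
    rw [Fintype.bijective_iff_injective_and_card]
    constructor
    · rintro (i | i) (j | j) h
      · fin_cases i <;> fin_cases j <;> simp [Fin.ext_iff] at h ⊢
      · fin_cases i <;> simp [Fin.ext_iff] at h
        omega
      · fin_cases j <;> simp [Fin.ext_iff] at h
        omega
      · simpa [Fin.ext_iff] using h
    · simp [add_comm]

/-- M times the first block column of its adjugate, completed by identity columns, is block
triangular with det M on the first block; determinants are then taken. -/
lemma det_mul_det_adjugate_block {n R : Type*} [Fintype n] [DecidableEq n] [CommRing R]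
    (M : Matrix (Fin 2 ⊕ n) (Fin 2 ⊕ n) R) :
    M.det * M.adjugate.toBlocks₁₁.det = M.det ^ 2 * M.toBlocks₂₂.det := by
  have h := congrArg Matrix.det (show
    M * Matrix.fromBlocks M.adjugate.toBlocks₁₁ 0 M.adjugate.toBlocks₂₁ 1 =
      Matrix.fromBlocks (M.det • 1) M.toBlocks₁₂ 0 M.toBlocks₂₂ from by
    have h1 := M.mul_adjugate
    rw [← Matrix.fromBlocks_toBlocks M, ← Matrix.fromBlocks_toBlocks
      (Matrix.fromBlocks M.toBlocks₁₁ M.toBlocks₁₂ M.toBlocks₂₁ M.toBlocks₂₂).adjugate,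
      Matrix.fromBlocks_multiply, ← Matrix.fromBlocks_one, Matrix.fromBlocks_smul] at h1
    simp only [Matrix.fromBlocks_toBlocks, Matrix.fromBlocks_inj] at h1
    conv_lhs => rw [← Matrix.fromBlocks_toBlocks M]
    rw [Matrix.fromBlocks_multiply]
    simp only [Matrix.fromBlocks_toBlocks, mul_one, Matrix.mul_zero, zero_add, Matrix.mul_one]
    rw [h1.1, h1.2.2.1, smul_zero])
  rw [Matrix.det_mul, Matrix.det_fromBlocks_zero₁₂, Matrix.det_fromBlocks_zero₂₁, Matrix.det_smul,
    Matrix.det_one, Matrix.det_one, Fintype.card_fin, mul_one, mul_one] at h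
  exact h

/-- The superfluous factor det M is cancelled for the generic matrix over ℤ, where it is nonzero in
a domain, and the identity is then specialised. -/
lemma det_adjugate_block {n R : Type*} [Fintype n] [DecidableEq n] [CommRing R]
    (M : Matrix (Fin 2 ⊕ n) (Fin 2 ⊕ n) R) :
    M.adjugate.toBlocks₁₁.det = M.det * M.toBlocks₂₂.det := by
  set X := Matrix.mvPolynomialX (Fin 2 ⊕ n) (Fin 2 ⊕ n) ℤ
  have hX : X.adjugate.toBlocks₁₁.det = X.det * X.toBlocks₂₂.det := by
    apply mul_left_cancel₀ (Matrix.det_mvPolynomialX_ne_zero (Fin 2 ⊕ n) ℤ)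
    rw [det_mul_det_adjugate_block, sq, mul_assoc]
  set φ : MvPolynomial ((Fin 2 ⊕ n) × (Fin 2 ⊕ n)) ℤ →ₐ[ℤ] R :=
    MvPolynomial.aeval fun p : (Fin 2 ⊕ n) × (Fin 2 ⊕ n) => M p.1 p.2
  have hM : φ.mapMatrix X = M := Matrix.mvPolynomialX_mapMatrix_aeval ℤ M
  have h := congrArg φ hX
  rw [map_mul, AlgHom.map_det, AlgHom.map_det, AlgHom.map_det, hM] at h
  have h1 : φ.mapMatrix X.adjugate.toBlocks₁₁ = M.adjugate.toBlocks₁₁ := by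
    rw [← hM, ← AlgHom.map_adjugate]
    rfl
  have h2 : φ.mapMatrix X.toBlocks₂₂ = M.toBlocks₂₂ := by
    rw [← hM]
    rfl
  rw [h1, h2] at h
  exact h

/-- The Desnanot–Jacobi identity. -/
theorem desnanot_jacobi {n : ℕ} (M : Matrix (Fin (n + 2)) (Fin (n + 2)) ℝ) :
    M.det * (M.submatrix (fun i : Fin n => i.succ.castSucc) fun i => i.succ.castSucc).det =
      (M.submatrix Fin.succ Fin.succ).det * (M.submatrix Fin.castSucc Fin.castSucc).det -
        (M.submatrix Fin.succ Fin.castSucc).det * (M.submatrix Fin.castSucc Fin.succ).det := by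
  have h := det_adjugate_block (M.submatrix (cornerEquiv n) (cornerEquiv n))
  rw [Matrix.adjugate_submatrix_equiv_self, Matrix.det_submatrix_equiv_self,
    Matrix.det_fin_two] at h
  have e0 : cornerEquiv n (Sum.inl 0) = 0 := rfl
  have e1 : cornerEquiv n (Sum.inl 1) = Fin.last (n + 1) := rfl
  have e2 : ∀ i, cornerEquiv n (Sum.inr i) = i.succ.castSucc := fun i => rfl
  have h22 : (M.submatrix (cornerEquiv n) (cornerEquiv n)).toBlocks₂₂ =
      M.submatrix (fun i : Fin n => i.succ.castSucc) fun i => i.succ.castSucc := rfl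
  rw [h22] at h
  rw [← h]
  simp only [Matrix.toBlocks₁₁, Matrix.of_apply, Matrix.submatrix_apply, e0, e1,
    Matrix.adjugate_fin_succ_eq_det_submatrix, Fin.succAbove_zero, Fin.succAbove_last,
    Fin.val_zero, Fin.val_last]
  have hsq : ((-1 : ℝ) ^ (n + 1)) * (-1) ^ (n + 1) = 1 := by
    rw [← mul_pow]; norm_num
  have hsq2 : ((-1 : ℝ) ^ (n + 1 + (n + 1))) = 1 := by rw [pow_add, hsq]
  rw [hsq2]
  simp only [add_zero, zero_add, pow_zero, one_mul]
  linear_combination (-(M.submatrix Fin.castSucc Fin.succ).det *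
    (M.submatrix Fin.succ Fin.castSucc).det) * hsq

/-! ### Identities between the determinants and the Pfaffians -/

lemma add_add_one_right (l p : ℤ) : l + (p + 1) = l + 1 + p := by ring

/-- The linear relations between moments and bimoments. -/
structure MomentRelations (μ : Measure ℝ) : Prop where
  symm : ∀ i j, bimomentI μ j i = bimomentI μ i j
  skew : ∀ i j, bimomentJ μ j i = -bimomentJ μ i j
  two_mul : ∀ i j, 2 * bimomentI μ (i + 1) j = beta μ i * beta μ j - bimomentJ μ i j

/-- The moments with indices `l, …, l + k - 1`. -/
def betaVec (μ : Measure ℝ) (l : ℤ) (k : ℕ) : Fin k → ℝ := fun p => beta μ (l + (p : ℕ))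

/-- The skew bimoments with indices `l, …, l + k - 1`. -/
def matJ (μ : Measure ℝ) (l : ℤ) (k : ℕ) : Matrix (Fin k) (Fin k) ℝ :=
  Matrix.of fun p q => bimomentJ μ (l + (p : ℕ)) (l + (q : ℕ))

lemma F_natCast (μ : Measure ℝ) (i j : ℤ) (k : ℕ) : F μ i j k =
    (Matrix.of fun p q : Fin k => bimomentI μ (i + (p : ℕ)) (j + (q : ℕ))).det := rfl

lemma tau_natCast (μ : Measure ℝ) (l : ℤ) (k : ℕ) :
    tau μ l k = tauAux (betaVec μ l k) (matJ μ l k) := by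
  change (if Even k then _ else _) = _
  unfold tauAux
  by_cases h : Even k
  · rw [if_pos h, dif_pos h]
    rfl
  · rw [if_neg h, dif_neg h]
    congr 1
    have key : ∀ i j : Fin (k + 1), (if (i : ℕ) = 0 then
            if (j : ℕ) = 0 then 0 else beta μ (l + (j : ℕ) - 1)
          else
            if (j : ℕ) = 0 then -beta μ (l + (i : ℕ) - 1)
            else bimomentJ μ (l + (i : ℕ) - 1) (l + (j : ℕ) - 1)) =
        border (betaVec μ l k) (matJ μ l k) i j := by
      intro i j
      refine Fin.cases ?_ (fun i => ?_) i <;> refine Fin.cases ?_ (fun j => ?_) j <;>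
        simp [betaVec, matJ, ← add_assoc]
    ext i j
    have hc := Nat.two_mul_div_two_of_even (Nat.even_add_one.2 h)
    exact key (Fin.cast hc i) (Fin.cast hc j)

lemma tau_zero (μ : Measure ℝ) (l : ℤ) : tau μ l 0 = 1 := by
  have := tau_natCast μ l 0
  rw [Nat.cast_zero] at this
  rw [this]
  exact (tauAux_even (m := 0) _ _).trans (pfaffian_zero _)

lemma F_zero (μ : Measure ℝ) (i j : ℤ) : F μ i j 0 = 1 := by
  have := F_natCast μ i j 0
  rw [Nat.cast_zero] at this
  rw [this]
  exact Matrix.det_fin_zero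

namespace MomentRelations

lemma matJ_skew {μ : Measure ℝ} (h : MomentRelations μ) (l : ℤ) (k : ℕ) (i j : Fin k) :
    matJ μ l k j i = -matJ μ l k i j :=
  h.skew _ _

lemma two_mul_right {μ : Measure ℝ} (h : MomentRelations μ) (i j : ℤ) :
    2 * bimomentI μ i (j + 1) = beta μ i * beta μ j + bimomentJ μ i j := by
  rw [← h.symm, h.two_mul, h.skew]
  ring

lemma rankOneSub_apply {μ : Measure ℝ} (h : MomentRelations μ) (l : ℤ) (k : ℕ) (p q : Fin k) :
    rankOneSub (betaVec μ l k) (matJ μ l k) p q =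
      2 * bimomentI μ (l + 1 + (p : ℕ)) (l + (q : ℕ)) := by
  rw [add_right_comm, h.two_mul]
  rfl

lemma F_comm {μ : Measure ℝ} (h : MomentRelations μ) (i j k : ℤ) : F μ i j k = F μ j i k := by
  cases k with
  | ofNat k =>
    refine (Matrix.det_transpose _).symm.trans (congrArg Matrix.det ?_)
    ext p q
    exact h.symm _ _
  | negSucc k => rfl

/-- `2^k F_k^{(l+1,l)} = (τ_k^{(l)})²`. -/
theorem two_pow_mul_F {μ : Measure ℝ} (h : MomentRelations μ) (l : ℤ) (k : ℕ) :
    2 ^ k * F μ (l + 1) l k = tau μ l k ^ 2 := by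
  rw [tau_natCast, ← det_rankOneSub_eq_sq _ (h.matJ_skew l k), F_natCast]
  have : rankOneSub (betaVec μ l k) (matJ μ l k) = (2 : ℝ) •
      Matrix.of fun p q : Fin k => bimomentI μ (l + 1 + (p : ℕ)) (l + (q : ℕ)) := by
    ext p q
    rw [h.rankOneSub_apply]
    rfl
  rw [this, Matrix.det_smul, Fintype.card_fin]

lemma betaVec_succ {μ : Measure ℝ} (l : ℤ) (k : ℕ) :
    (fun i : Fin k => betaVec μ l (k + 1) i.succ) = betaVec μ (l + 1) k := by
  funext i
  simp [betaVec, add_add_one_right]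

lemma matJ_succ {μ : Measure ℝ} (l : ℤ) (k : ℕ) :
    (matJ μ l (k + 1)).submatrix Fin.succ Fin.succ = matJ μ (l + 1) k := by
  ext i j
  simp [matJ, add_add_one_right]

lemma det_updateCol {μ : Measure ℝ} (h : MomentRelations μ) (l : ℤ) (k : ℕ) :
    ((rankOneSub (betaVec μ l (k + 1)) (matJ μ l (k + 1))).updateCol 0
      (betaVec μ l (k + 1))).det = tau μ l (k + 1 : ℕ) * tau μ (l + 1) k := by
  rw [det_updateCol_rankOneSub _ (h.matJ_skew l (k + 1)), betaVec_succ, matJ_succ,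
    tau_natCast, tau_natCast]

/-- `2^{k-1} G_k^{(l,l+2)} = τ_k^{(l)} τ_{k-1}^{(l+1)}`. -/
theorem two_pow_mul_G {μ : Measure ℝ} (h : MomentRelations μ) (l : ℤ) (k : ℕ) :
    2 ^ k * G μ l (l + 2) (k + 1 : ℕ) = tau μ l (k + 1 : ℕ) * tau μ (l + 1) k := by
  rw [← h.det_updateCol]
  -- Since β_i β_j - J_{i,j} = 2 β_i β_j - 2 I_{i,j+1}, subtracting multiples of the first column β
  -- turns the other columns into -2 I.
  set B : Matrix (Fin (k + 1)) (Fin (k + 1)) ℝ := Matrix.of fun p =>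
    Fin.cons (beta μ (l + (p : ℕ)))
      fun q : Fin k => -2 * bimomentI μ (l + (p : ℕ)) (l + 2 + (q : ℕ)) with hB
  have h1 : ((rankOneSub (betaVec μ l (k + 1)) (matJ μ l (k + 1))).updateCol 0
      (betaVec μ l (k + 1))).det = B.det := by
    rw [← Matrix.det_transpose, ← Matrix.det_transpose B]
    refine Matrix.det_eq_of_forall_row_eq_smul_add_const
      (Fin.cons 0 fun q : Fin k => 2 * beta μ (l + 1 + (q : ℕ))) 0 rfl ?_
    intro q p
    refine Fin.cases ?_ (fun q => ?_) q
    · simp [hB, betaVec]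
    · have e1 : l + 2 + ((q : ℕ) : ℤ) = (l + 1 + (q : ℕ)) + 1 := by ring
      have e2 : l + ((q.succ : ℕ) : ℤ) = l + 1 + (q : ℕ) := by simp; ring
      have := h.two_mul_right (l + (p : ℕ)) (l + 1 + (q : ℕ))
      simp only [Matrix.transpose_apply, hB, Matrix.of_apply, Fin.cons_succ, Fin.cons_zero, e1]
      rw [Matrix.updateCol_ne (Fin.succ_ne_zero _)]
      simp only [rankOneSub, betaVec, matJ, Matrix.of_apply, e2]
      linarith
  -- Rotation puts the column β last, as in `G`; its sign (-1)^k cancels that of the k factors -2.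
  have h2 : (B.submatrix id (finRotate (k + 1))).det =
      (∏ q : Fin (k + 1), if (q : ℕ) < k then (-2 : ℝ) else 1) * G μ l (l + 2) (k + 1 : ℕ) := by
    change _ = _ * (Matrix.of fun p q : Fin (k + 1) =>
        if (q : ℕ) < k then bimomentI μ (l + (p : ℕ)) (l + 2 + (q : ℕ))
        else beta μ (l + (p : ℕ))).det
    rw [← Matrix.det_mul_row]
    congr 1
    ext p q
    refine Fin.lastCases ?_ (fun q => ?_) q
    · simp [hB]
    · simp [hB]
  rw [Matrix.det_permute', sign_finRotate, Fin.prod_univ_castSucc] at h2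
  simp at h2
  rw [h1]
  have hs : ((-1 : ℝ) ^ k) * (-1) ^ k = 1 := by rw [← mul_pow]; norm_num
  have hs2 : (-2 : ℝ) ^ k = (-1) ^ k * 2 ^ k := by rw [← mul_pow]; norm_num
  rw [hs2] at h2
  push_cast at h2 ⊢
  linear_combination (-(-1 : ℝ) ^ k) * h2 + (B.det - 2 ^ k * G μ l (l + 2) (k + 1)) * hs

/-- Rotating the last index to the front before applying `det_updateCol_rankOneSub` makes the second
τ drop the last index instead of the first, hence the unshifted τ_k^{(l)}. -/
lemma det_updateCol_last {μ : Measure ℝ} (h : MomentRelations μ) (l : ℤ) (k : ℕ) :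
    (Matrix.of fun p => (Fin.cons (betaVec μ l (k + 1) p)
      fun q : Fin k => rankOneSub (betaVec μ l (k + 1)) (matJ μ l (k + 1)) p q.castSucc
        : Fin (k + 1) → ℝ)).det = tau μ l (k + 1 : ℕ) * tau μ l k := by
  set β := betaVec μ l (k + 1)
  set J := matJ μ l (k + 1)
  set s : Perm (Fin (k + 1)) := (finRotate (k + 1)).symm
  have hs0 : s 0 = Fin.last k := by
    rw [Equiv.symm_apply_eq, finRotate_last]
  have hs1 : ∀ i : Fin k, s i.succ = i.castSucc := by
    intro i
    rw [Equiv.symm_apply_eq, finRotate_apply]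
    ext; simp
  have h1 := det_updateCol_rankOneSub (β ∘ s) (J := J.submatrix s s)
    fun i j => h.matJ_skew _ _ _ _
  rw [tauAux_perm _ (h.matJ_skew l (k + 1)), ← tau_natCast] at h1
  have h2 : tauAux (fun i : Fin k => (β ∘ s) i.succ)
      ((J.submatrix s s).submatrix Fin.succ Fin.succ) = tau μ l k := by
    rw [tau_natCast]
    congr 1
    · funext i
      simp [hs1, β, betaVec]
    · ext i j
      simp [hs1, J, matJ]
  have h3 : (rankOneSub (β ∘ s) (J.submatrix s s)).updateCol 0 (β ∘ s) =
      (Matrix.of fun p => (Fin.cons (β p)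
        fun q : Fin k => rankOneSub β J p q.castSucc : Fin (k + 1) → ℝ)).submatrix s id := by
    ext p q
    refine Fin.cases ?_ (fun q => ?_) q
    · simp
    · rw [Matrix.updateCol_ne (Fin.succ_ne_zero _)]
      simp [rankOneSub, hs1]
  rw [h2, h3, Matrix.det_permute] at h1
  have hu : ((Perm.sign s : ℤ) : ℝ) ≠ 0 := by
    rcases Int.units_eq_one_or (Perm.sign s) with e | e <;> simp [e]
  apply mul_left_cancel₀ hu
  rw [h1, mul_assoc]

/-- The Pfaffian bilinear expression for `F_k^{(l+1,l+1)}`. -/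
theorem two_pow_mul_F_diag {μ : Measure ℝ} (h : MomentRelations μ) (l : ℤ) (k : ℕ) (h1 : tau μ (l + 1) k ≠ 0)
    (h2 : tau μ (l + 1) (k + 1 : ℕ) ≠ 0) :
    2 ^ (k + 1) * F μ (l + 1) (l + 1) (k + 1 : ℕ) =
      tau μ (l + 1) (k + 1 : ℕ) * tau μ l (k + 1 : ℕ) - tau μ (l + 1) k * tau μ l (k + 2 : ℕ) := by
  -- In this matrix of size k + 2 with first column β, deleting the last row and first column leaves
  -- twice the bimoment matrix of F^{(l+1,l+1)}; the other determinants in the identity are products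
  -- of two τ's. The common factor τ_k^{(l+1)} τ_{k+1}^{(l+1)} is cancelled at the end, whence the
  -- nonvanishing hypotheses.
  have hd := desnanot_jacobi ((rankOneSub (betaVec μ l (k + 2)) (matJ μ l (k + 2))).updateCol 0
    (betaVec μ l (k + 2)))
  rw [h.det_updateCol l (k + 1)] at hd
  have e1 : (((rankOneSub (betaVec μ l (k + 2)) (matJ μ l (k + 2))).updateCol 0
      (betaVec μ l (k + 2))).submatrix (fun i : Fin k => i.succ.castSucc)
        fun i => i.succ.castSucc).det = tau μ (l + 1) k ^ 2 := by
    rw [tau_natCast, ← det_rankOneSub_eq_sq _ (h.matJ_skew _ k)]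
    congr 1
    ext p q
    rw [Matrix.submatrix_apply, Matrix.updateCol_ne (by simp [Fin.ext_iff])]
    simp [rankOneSub, betaVec, matJ, add_add_one_right]
  have e2 : (((rankOneSub (betaVec μ l (k + 2)) (matJ μ l (k + 2))).updateCol 0
      (betaVec μ l (k + 2))).submatrix Fin.succ Fin.succ).det =
        tau μ (l + 1) (k + 1 : ℕ) ^ 2 := by
    rw [tau_natCast, ← det_rankOneSub_eq_sq _ (h.matJ_skew _ (k + 1))]
    congr 1
    ext p q
    rw [Matrix.submatrix_apply, Matrix.updateCol_ne (Fin.succ_ne_zero _)]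
    simp [rankOneSub, betaVec, matJ, add_add_one_right]
  have e3 : (((rankOneSub (betaVec μ l (k + 2)) (matJ μ l (k + 2))).updateCol 0
      (betaVec μ l (k + 2))).submatrix Fin.castSucc Fin.castSucc).det =
        tau μ l (k + 1 : ℕ) * tau μ (l + 1) k := by
    rw [← h.det_updateCol l k]
    congr 1
    ext p q
    refine Fin.cases ?_ (fun q => ?_) q
    · simp [betaVec]
    · rw [Matrix.submatrix_apply, Matrix.updateCol_ne
        (Fin.ne_of_val_ne (by simp) : q.succ.castSucc ≠ (0 : Fin (k + 2))),
        Matrix.updateCol_ne (Fin.succ_ne_zero _)]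
      simp [rankOneSub, betaVec, matJ]
  have e4 : (((rankOneSub (betaVec μ l (k + 2)) (matJ μ l (k + 2))).updateCol 0
      (betaVec μ l (k + 2))).submatrix Fin.castSucc Fin.succ).det =
        2 ^ (k + 1) * F μ (l + 1) (l + 1) (k + 1 : ℕ) := by
    have : ((rankOneSub (betaVec μ l (k + 2)) (matJ μ l (k + 2))).updateCol 0
      (betaVec μ l (k + 2))).submatrix Fin.castSucc Fin.succ = (2 : ℝ) •
      Matrix.of fun p q : Fin (k + 1) =>
        bimomentI μ (l + 1 + (p : ℕ)) (l + 1 + (q : ℕ)) := by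
      ext p q
      rw [Matrix.submatrix_apply, Matrix.updateCol_ne (Fin.succ_ne_zero _),
        h.rankOneSub_apply]
      simp [add_add_one_right]
    rw [this, Matrix.det_smul, Fintype.card_fin, F_natCast]
  have e5 : (((rankOneSub (betaVec μ l (k + 2)) (matJ μ l (k + 2))).updateCol 0
      (betaVec μ l (k + 2))).submatrix Fin.succ Fin.castSucc).det =
        tau μ (l + 1) (k + 1 : ℕ) * tau μ (l + 1) k := by
    rw [← h.det_updateCol_last (l + 1) k]
    congr 1
    ext p q
    refine Fin.cases ?_ (fun q => ?_) q
    · simp [betaVec, add_add_one_right]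
    · rw [Matrix.submatrix_apply, Matrix.updateCol_ne (by simp [Fin.ext_iff])]
      simp [rankOneSub, betaVec, matJ, add_add_one_right]
  rw [e1, e2, e3, e4, e5] at hd
  apply mul_left_cancel₀ (mul_ne_zero h1 h2)
  linear_combination hd

/-- The Desnanot–Jacobi identity for the bimoment determinants. -/
theorem F_desnanot {μ : Measure ℝ} (h : MomentRelations μ) (l : ℤ) (k : ℕ) :
    F μ l l (k + 2 : ℕ) * F μ (l + 1) (l + 1) k =
      F μ (l + 1) (l + 1) (k + 1 : ℕ) * F μ l l (k + 1 : ℕ) -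
        F μ (l + 1) l (k + 1 : ℕ) ^ 2 := by
  have hd := desnanot_jacobi
    (Matrix.of fun p q : Fin (k + 2) => bimomentI μ (l + (p : ℕ)) (l + (q : ℕ)))
  rw [show F μ (l + 1) l (k + 1 : ℕ) ^ 2 = F μ (l + 1) l (k + 1 : ℕ) * F μ l (l + 1) (k + 1 : ℕ) by
    rw [sq, h.F_comm l (l + 1)]]
  simp only [F_natCast]
  convert hd using 4 <;>
    ext p q <;> simp [add_add_one_right]

end MomentRelations

/-! ### Positivity of Pfaffians -/

lemma pairFun_bijective (m : ℕ) (n : Type*) :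
    Function.Bijective (pairFun : (Fin m → n × n) → Fin (2 * m) → n) := by
  constructor
  · intro g g' h
    funext l
    have h0 := congrFun h (pairEquiv m (l, 0))
    have h1 := congrFun h (pairEquiv m (l, 1))
    simp [pairFun] at h0 h1
    exact Prod.ext h0 h1
  · intro f
    refine ⟨fun l => (f (pairEquiv m (l, 0)), f (pairEquiv m (l, 1))), funext fun i => ?_⟩
    obtain ⟨⟨l, c⟩, rfl⟩ := (pairEquiv m).surjective i
    have hc : c = 0 ∨ c = 1 := by omega
    rcases hc with rfl | rfl <;> simp [pairFun]

lemma sum_pfTerm_eq_sum_fun {m : ℕ} {n : Type*} [Fintype n]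
    (B : Matrix (Fin (2 * m)) n ℝ) (A : Matrix n n ℝ) :
    ∑ σ, pfTerm (B * A * B.transpose) σ = ∑ f : Fin (2 * m) → n,
      (∏ l, A (f (pairEquiv m (l, 0))) (f (pairEquiv m (l, 1)))) * (B.submatrix id f).det := by
  rw [sum_pfTerm_mul_mul_transpose]
  refine Fintype.sum_bijective pairFun (pairFun_bijective m n) _ _ fun g => ?_
  simp [pairFun]

/-- The Pfaffian version of the Cauchy–Binet formula, in symmetrized form. -/
theorem factorial_mul_pfaffian {m : ℕ} {n : Type*} [Fintype n]
    (B : Matrix (Fin (2 * m)) n ℝ) {A : Matrix n n ℝ} (hA : ∀ i j, A j i = -A i j) :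
    ((2 * m).factorial : ℝ) * pfaffian m (B * A * B.transpose) =
      ∑ f : Fin (2 * m) → n, pfaffian m (A.submatrix f f) * (B.submatrix id f).det := by
  have hc : (m.factorial * 2 ^ m : ℝ) ≠ 0 := by positivity
  apply mul_left_cancel₀ hc
  rw [mul_left_comm, ← sum_pfTerm (skew_mul_mul_transpose hA B), sum_pfTerm_eq_sum_fun]
  set t : (Fin (2 * m) → n) → ℝ := fun f =>
    (∏ l, A (f (pairEquiv m (l, 0))) (f (pairEquiv m (l, 1)))) * (B.submatrix id f).det with ht
  -- Averaging over reorderings of `f`: the minor picks up the sign of σ, so the products of entries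
  -- of `A` assemble into a sum of Pfaffian terms.
  have h1 : ∀ σ : Perm (Fin (2 * m)), ∑ f, t f = ∑ f : Fin (2 * m) → n, t (f ∘ σ) := by
    intro σ
    exact (Equiv.sum_comp (Equiv.arrowCongr σ.symm (Equiv.refl n)) t).symm
  have h2 : ((2 * m).factorial : ℝ) * ∑ f, t f =
      ∑ f : Fin (2 * m) → n, ∑ σ : Perm (Fin (2 * m)), t (f ∘ σ) := by
    rw [sum_comm, ← sum_congr rfl fun σ _ => h1 σ, sum_const, nsmul_eq_mul]
    simp [Fintype.card_perm]
  rw [h2, mul_sum]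
  refine sum_congr rfl fun f _ => ?_
  rw [← mul_assoc, ← sum_pfTerm (A := A.submatrix f f) fun i j => hA _ _, sum_mul]
  refine sum_congr rfl fun σ _ => ?_
  have h3 : B.submatrix id (f ∘ σ) = (B.submatrix id f).submatrix id σ := rfl
  simp only [ht]
  rw [h3, Matrix.det_permute', pfTerm]
  simp only [Function.comp_apply, Matrix.submatrix_apply]
  ring

/-- In the Cauchy–Binet sum, Schur's Pfaffian contributes the differences x_j - x_i over positive
sums and the minor is a nonnegative multiple of the same differences, so only squares remain.
Positivity of sums is asked only for i ≠ j, which admits one node at 0. -/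
theorem pfaffian_schur_pos {m : ℕ} {n : Type*} [Fintype n] {x : n → ℝ}
    (hx : Function.Injective x) (hs : ∀ i j, i ≠ j → 0 < x i + x j)
    (V : Matrix (Fin (2 * m)) n ℝ)
    (hV : ∀ f : Fin (2 * m) → n, Function.Injective f →
      ∃ c : ℝ, 0 ≤ c ∧ (V.submatrix id f).det = c * ∏ i, ∏ j ∈ Ioi i, (x (f j) - x (f i)))
    (hpos : ∃ f : Fin (2 * m) → n, Function.Injective f ∧ (V.submatrix id f).det ≠ 0) :
    0 < pfaffian m (V * schurMatrix x * V.transpose) := by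
  have hf : (0 : ℝ) < (2 * m).factorial := by positivity
  refine pos_of_mul_pos_right (a := ((2 * m).factorial : ℝ)) ?_ hf.le
  rw [factorial_mul_pfaffian V (schurMatrix_skew x)]
  have hpf : ∀ f : Fin (2 * m) → n, Function.Injective f →
      pfaffian m ((schurMatrix x).submatrix f f) =
        ∏ i, ∏ j ∈ Ioi i, (x (f j) - x (f i)) / (x (f i) + x (f j)) := by
    intro f hfi
    exact pfaffian_schurMatrix (x ∘ f) (hx.comp hfi) fun i j hij => (hs _ _ (hfi.ne hij)).ne'
  have hnn : ∀ f : Fin (2 * m) → n,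
      0 ≤ pfaffian m ((schurMatrix x).submatrix f f) * (V.submatrix id f).det := by
    intro f
    by_cases hfi : Function.Injective f
    · obtain ⟨c, hc, hdet⟩ := hV f hfi
      rw [hpf f hfi, hdet, mul_left_comm]
      refine mul_nonneg hc ?_
      rw [← prod_mul_distrib]
      refine prod_nonneg fun i _ => ?_
      rw [← prod_mul_distrib]
      refine prod_nonneg fun j hj => ?_
      rw [div_mul_eq_mul_div]
      exact div_nonneg (mul_self_nonneg _)
        (hs _ _ (hfi.ne (mem_Ioi.1 hj).ne)).le
    · rw [Function.not_injective_iff] at hfi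
      obtain ⟨i, j, hij, hne⟩ := hfi
      rw [Matrix.det_zero_of_column_eq hne fun k => by simp [hij], mul_zero]
  refine sum_pos' (fun f _ => hnn f) ?_
  obtain ⟨f, hfi, hdet⟩ := hpos
  refine ⟨f, mem_univ _, lt_of_le_of_ne (hnn f) (mul_ne_zero ?_ hdet).symm⟩
  rw [hpf f hfi]
  refine prod_ne_zero_iff.2 fun i _ => prod_ne_zero_iff.2 fun j hj => ?_
  have hij : i ≠ j := (mem_Ioi.1 hj).ne
  exact div_ne_zero (sub_ne_zero.2 (hx.ne (hfi.ne hij.symm))) (hs _ _ (hfi.ne hij)).ne'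

/-! ### The Cauchy kernel -/

/-- The Cauchy kernel `1 / (x_i + x_j)`. -/
def cauchyMatrix {n : Type*} (x : n → ℝ) : Matrix n n ℝ := Matrix.of fun i j => 1 / (x i + x j)

/-- With a = x₀, 1/(x+y) = 2a/((x+a)(y+a)) + (x-a)(y-a)/((x+a)(y+a)(x+y)). The first part is a
square, and the second is the same form on the remaining nodes because its weight vanishes at a. -/
lemma sum_cauchy_pos {n : ℕ} (x c : Fin n → ℝ) (hx : Function.Injective x) (hp : ∀ i, 0 < x i)
    (hc : c ≠ 0) : 0 < ∑ i, ∑ j, c i * c j / (x i + x j) := by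
  induction n with
  | zero => exact absurd (Subsingleton.elim _ _) hc
  | succ n ih =>
    have hne : ∀ i j, x i + x j ≠ 0 := fun i j => (add_pos (hp i) (hp j)).ne'
    set d : Fin n → ℝ := fun i => c i.succ * ((x i.succ - x 0) / (x i.succ + x 0)) with hd
    have hrec : ∑ i, ∑ j, c i * c j / (x i + x j) =
        2 * x 0 * (∑ i, c i / (x i + x 0)) ^ 2 +
          ∑ i, ∑ j, d i * d j / (x i.succ + x j.succ) := by
      have h1 : ∑ i : Fin n, ∑ j : Fin n, d i * d j / (x i.succ + x j.succ) =
          ∑ i : Fin (n + 1), ∑ j : Fin (n + 1), (c i * ((x i - x 0) / (x i + x 0))) *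
            (c j * ((x j - x 0) / (x j + x 0))) / (x i + x j) := by
        simp only [Fin.sum_univ_succ (n := n)]
        simp [hd]
      rw [h1, sq, sum_mul_sum, mul_sum, ← sum_add_distrib]
      refine sum_congr rfl fun i _ => ?_
      rw [mul_sum, ← sum_add_distrib]
      refine sum_congr rfl fun j _ => ?_
      have := hne i j
      have := hne i 0
      have := hne j 0
      field_simp
      ring
    rw [hrec]
    by_cases hd0 : d = 0
    · have hcs : ∀ i : Fin n, c i.succ = 0 := by
        intro i
        have h1 := congrFun hd0 i
        simp only [hd, Pi.zero_apply, mul_eq_zero] at h1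
        rcases h1 with h1 | h1
        · exact h1
        · exact absurd h1 (div_ne_zero (sub_ne_zero.2 (hx.ne (Fin.succ_ne_zero i))) (hne _ _))
      have hc0 : c 0 ≠ 0 := by
        intro h0
        apply hc
        funext i
        refine Fin.cases h0 hcs i
      have hx0 := hp 0
      rw [hd0, Fin.sum_univ_succ]
      simp only [hcs, Pi.zero_apply, zero_mul, zero_div, sum_const_zero, add_zero]
      have : c 0 / (x 0 + x 0) ≠ 0 := div_ne_zero hc0 (hne _ _)
      positivity
    · have h2 := ih (fun i => x i.succ) d (hx.comp (Fin.succ_injective _)) (fun i => hp _) hd0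
      have hx0 := hp 0
      have : 0 ≤ 2 * x 0 * (∑ i, c i / (x i + x 0)) ^ 2 := by positivity
      linarith

lemma cauchyMatrix_posDef {n : ℕ} {x : Fin n → ℝ} (hx : Function.Injective x)
    (hp : ∀ i, 0 < x i) : (cauchyMatrix x).PosDef := by
  rw [Matrix.posDef_iff_dotProduct_mulVec]
  constructor
  · exact Matrix.IsHermitian.ext fun i j => by simp [cauchyMatrix, add_comm]
  · intro c hc
    refine lt_of_lt_of_eq (sum_cauchy_pos x c hx hp hc) ?_
    simp only [dotProduct, Matrix.mulVec, mul_sum]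
    refine sum_congr rfl fun i _ => sum_congr rfl fun j _ => ?_
    simp [cauchyMatrix]
    ring

/-! ### Discrete measures -/

section discrete

variable {N : ℕ} {ζ b : Fin N → ℝ}

lemma integral_discreteMeasure (hb : ∀ j, 0 < b j) (f : ℝ → ℝ) :
    ∫ x, f x ∂discreteMeasure ζ b = ∑ j, b j * f (ζ j) := by
  rw [discreteMeasure, integral_finsetSum_measure]
  · refine sum_congr rfl fun j _ => ?_
    rw [integral_smul_measure, integral_dirac, ENNReal.toReal_ofReal (hb j).le, smul_eq_mul]
  · intro j _
    exact (integrable_dirac (by simp)).smul_measure ENNReal.ofReal_ne_top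

lemma beta_discrete (hb : ∀ j, 0 < b j) (n : ℤ) :
    beta (discreteMeasure ζ b) n = ∑ j, b j * ζ j ^ n := integral_discreteMeasure hb _

lemma bimomentI_discrete (hb : ∀ j, 0 < b j) (m n : ℤ) :
    bimomentI (discreteMeasure ζ b) m n =
      ∑ i, ∑ j, b i * b j * (ζ i ^ m * ζ j ^ n / (ζ i + ζ j)) := by
  simp only [bimomentI, integral_discreteMeasure hb, mul_sum, mul_assoc]

lemma bimomentJ_discrete (hb : ∀ j, 0 < b j) (m n : ℤ) :
    bimomentJ (discreteMeasure ζ b) m n =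
      ∑ i, ∑ j, b i * b j * ((ζ j - ζ i) / (ζ i + ζ j) * ζ i ^ m * ζ j ^ n) := by
  simp only [bimomentJ, integral_discreteMeasure hb, mul_sum, mul_assoc]

lemma momentRelations_discrete (hζ : ∀ j, 0 < ζ j) (hb : ∀ j, 0 < b j) :
    MomentRelations (discreteMeasure ζ b) where
  symm m n := by
    rw [bimomentI_discrete hb, bimomentI_discrete hb, sum_comm]
    refine sum_congr rfl fun i _ => sum_congr rfl fun j _ => ?_
    rw [add_comm (ζ j)]
    ring
  skew m n := by
    rw [bimomentJ_discrete hb, bimomentJ_discrete hb, sum_comm, ← sum_neg_distrib]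
    refine sum_congr rfl fun i _ => ?_
    rw [← sum_neg_distrib]
    refine sum_congr rfl fun j _ => ?_
    rw [add_comm (ζ j)]
    ring
  two_mul m n := by
    rw [bimomentI_discrete hb, bimomentJ_discrete hb, beta_discrete hb, beta_discrete hb,
      sum_mul_sum, mul_sum, ← sum_sub_distrib]
    refine sum_congr rfl fun i _ => ?_
    rw [mul_sum, ← sum_sub_distrib]
    refine sum_congr rfl fun j _ => ?_
    have := (add_pos (hζ i) (hζ j)).ne'
    rw [zpow_add_one₀ (hζ i).ne']
    field_simp
    ring

/-- The moment matrix `b_j ζ_j^{l+p}`. -/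
def momentMatrix (ζ b : Fin N → ℝ) (l : ℤ) (k : ℕ) : Matrix (Fin k) (Fin N) ℝ :=
  Matrix.of fun p j => b j * ζ j ^ (l + (p : ℕ))

lemma momentMatrix_mul_mul_transpose_apply (l l' : ℤ) (k : ℕ) (A : Matrix (Fin N) (Fin N) ℝ)
    (p q : Fin k) :
    (momentMatrix ζ b l k * A * (momentMatrix ζ b l' k).transpose) p q =
      ∑ i, ∑ j, b i * b j * (A i j * ζ i ^ (l + (p : ℕ)) * ζ j ^ (l' + (q : ℕ))) := by
  simp only [Matrix.mul_apply, Matrix.transpose_apply, sum_mul]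
  rw [sum_comm]
  refine sum_congr rfl fun i _ => sum_congr rfl fun j _ => ?_
  simp only [momentMatrix, Matrix.of_apply]
  ring

lemma bimoment_matrix_eq (hb : ∀ j, 0 < b j) (l : ℤ) (k : ℕ) :
    (Matrix.of fun p q : Fin k =>
      bimomentI (discreteMeasure ζ b) (l + (p : ℕ)) (l + (q : ℕ))) =
    momentMatrix ζ b l k * cauchyMatrix ζ * (momentMatrix ζ b l k).transpose := by
  ext p q
  rw [momentMatrix_mul_mul_transpose_apply, Matrix.of_apply, bimomentI_discrete hb]
  refine sum_congr rfl fun i _ => sum_congr rfl fun j _ => ?_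
  simp only [cauchyMatrix, Matrix.of_apply]
  ring

lemma matJ_discrete (hb : ∀ j, 0 < b j) (l : ℤ) (k : ℕ) :
    matJ (discreteMeasure ζ b) l k =
      momentMatrix ζ b l k * schurMatrix ζ * (momentMatrix ζ b l k).transpose := by
  ext p q
  rw [momentMatrix_mul_mul_transpose_apply, matJ, Matrix.of_apply, bimomentJ_discrete hb]
  rfl

/-- The matrix is V C Vᵀ with C the positive definite Cauchy matrix; the rows of V are independent
by a Vandermonde argument on the first k ≤ N nodes. -/
theorem F_diag_pos (hζ : StrictMono ζ) (hp : ∀ j, 0 < ζ j) (hb : ∀ j, 0 < b j) (l : ℤ) {k : ℕ}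
    (hk : k ≤ N) : 0 < F (discreteMeasure ζ b) l l k := by
  rw [F_natCast, bimoment_matrix_eq hb]
  have := (cauchyMatrix_posDef hζ.injective hp).mul_mul_conjTranspose_same
    (B := momentMatrix ζ b l k) ?_
  · exact this.det_pos
  · intro u v huv
    rw [← sub_eq_zero]
    apply Matrix.eq_zero_of_forall_index_sum_mul_pow_eq_zero
      (hζ.injective.comp (Fin.castLE_injective hk))
    intro j
    have h1 := congrFun huv (Fin.castLE hk j)
    simp only [Matrix.vecMul, dotProduct, momentMatrix, Matrix.of_apply] at h1
    have h2 : (b (Fin.castLE hk j) * ζ (Fin.castLE hk j) ^ l) *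
        ∑ i, (u - v) i * (ζ ∘ Fin.castLE hk) j ^ (i : ℕ) = 0 := by
      rw [mul_sum]
      rw [← sub_eq_zero, ← sum_sub_distrib] at h1
      rw [← h1]
      refine sum_congr rfl fun i _ => ?_
      rw [zpow_add₀ (hp _).ne', zpow_natCast]
      simp only [Pi.sub_apply, Function.comp_apply]
      ring
    have h3 : b (Fin.castLE hk j) * ζ (Fin.castLE hk j) ^ l ≠ 0 :=
      mul_ne_zero (hb _).ne' (zpow_ne_zero _ (hp _).ne')
    exact (mul_eq_zero.1 h2).resolve_left h3

/-- A matrix of size N + 1 that factors through N atoms has rank at most N. This supplies the end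
point of the telescoping sum in `xmToYn_dpFormula`. -/
theorem F_diag_eq_zero (hb : ∀ j, 0 < b j) (l : ℤ) :
    F (discreteMeasure ζ b) l l (N + 1 : ℕ) = 0 := by
  rw [F_natCast, bimoment_matrix_eq hb, Matrix.mul_assoc]
  by_contra h
  have h1 := Matrix.rank_of_isUnit _ ((Matrix.isUnit_iff_isUnit_det _).2 (isUnit_iff_ne_zero.2 h))
  have h2 := (Matrix.rank_mul_le_left (momentMatrix ζ b l (N + 1))
    (cauchyMatrix ζ * (momentMatrix ζ b l (N + 1)).transpose)).trans
      (Matrix.rank_le_width _)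
  rw [h1, Fintype.card_fin] at h2
  omega

lemma det_of_mul_pow {n : Type*} {k : ℕ} (d x : n → ℝ) (f : Fin k → n) :
    (Matrix.of fun p i : Fin k => d (f i) * x (f i) ^ (p : ℕ)).det =
      (∏ i, d (f i)) * ∏ i, ∏ j ∈ Ioi i, (x (f j) - x (f i)) := by
  have h1 : (Matrix.of fun p i : Fin k => d (f i) * x (f i) ^ (p : ℕ)) =
      Matrix.of fun p i => d (f i) * (Matrix.vandermonde (x ∘ f)).transpose p i := rfl
  rw [h1, Matrix.det_mul_row, Matrix.det_transpose, Matrix.det_vandermonde]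
  rfl

/-- The moment matrix of the measure with an additional atom at `0`. -/
def borderedMomentMatrix (ζ b : Fin N → ℝ) (l : ℤ) (k : ℕ) :
    Matrix (Fin (k + 1)) (Fin (N + 1)) ℝ :=
  Matrix.of (Fin.cons (Fin.cons 1 0) fun p => Fin.cons 0 (momentMatrix ζ b l k p))

/-- Against a node at 0 the kernel (y-x)/(x+y) is constantly 1, so the extra atom reproduces the
border of moments. The corner is 0/0, which is 0 by convention. -/
lemma border_discrete (hp : ∀ j, 0 < ζ j) (hb : ∀ j, 0 < b j) (l : ℤ) (k : ℕ) :
    border (betaVec (discreteMeasure ζ b) l k) (matJ (discreteMeasure ζ b) l k) =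
      borderedMomentMatrix ζ b l k * schurMatrix (Fin.cons 0 ζ : Fin (N + 1) → ℝ) *
        (borderedMomentMatrix ζ b l k).transpose := by
  rw [matJ_discrete hb]
  ext p q
  refine Fin.cases ?_ (fun p => ?_) p <;> refine Fin.cases ?_ (fun q => ?_) q
  · simp [Matrix.mul_apply, Fin.sum_univ_succ, borderedMomentMatrix, schurMatrix]
  · simp [Matrix.mul_apply, Fin.sum_univ_succ, borderedMomentMatrix, schurMatrix, betaVec,
      beta_discrete hb, (hp _).ne', momentMatrix]
  · simp [Matrix.mul_apply, Fin.sum_univ_succ, borderedMomentMatrix, schurMatrix, betaVec,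
      beta_discrete hb, (hp _).ne', momentMatrix]
  · simp [Matrix.mul_apply, Fin.sum_univ_succ, borderedMomentMatrix, schurMatrix]

/-- The column of the node 0 is (1, 0, …, 0), the column of powers of 0 with 0⁰ = 1. Expanding along
it discards the first row of the other columns, and in the remaining rows l + p = (l - 1) + (p + 1),
so a weighted Vandermonde determinant results. -/
lemma det_borderedMomentMatrix (hp : ∀ j, 0 < ζ j) (l : ℤ) {k : ℕ} (f : Fin (k + 1) → Fin (N + 1))
    (hf : Function.Injective f) {i₀ : Fin (k + 1)} (hi₀ : f i₀ = 0) :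
    ((borderedMomentMatrix ζ b l k).submatrix id f).det =
      (∏ i, (Fin.cons 1 (fun j => b j * ζ j ^ (l - 1)) : Fin (N + 1) → ℝ) (f i)) *
        ∏ i, ∏ j ∈ Ioi i, ((Fin.cons 0 ζ : Fin (N + 1) → ℝ) (f j) -
          (Fin.cons 0 ζ : Fin (N + 1) → ℝ) (f i)) := by
  rw [← det_of_mul_pow, Matrix.det_succ_column _ i₀, Matrix.det_succ_column _ i₀]
  refine sum_congr rfl fun p _ => ?_
  refine Fin.cases ?_ (fun p => ?_) p
  · congr 1
    · simp [borderedMomentMatrix, hi₀]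
    · congr 1
      ext q i
      have hne : f (i₀.succAbove i) ≠ 0 := by
        rw [← hi₀]
        exact hf.ne (Fin.succAbove_ne _ _)
      obtain ⟨j, hj⟩ := Fin.exists_succ_eq.2 hne
      simp only [Matrix.submatrix_apply, Matrix.of_apply, id, ← hj, Fin.cons_succ,
        Fin.succAbove_zero, borderedMomentMatrix, momentMatrix, Fin.val_succ]
      rw [mul_assoc, ← zpow_natCast, ← zpow_add₀ (hp j).ne']
      congr 2
      push_cast
      ring
  · simp [borderedMomentMatrix, hi₀]

theorem tau_pos (hζ : StrictMono ζ) (hp : ∀ j, 0 < ζ j) (hb : ∀ j, 0 < b j) (l : ℤ) {k : ℕ}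
    (hk : k ≤ N) : 0 < tau (discreteMeasure ζ b) l k := by
  rw [tau_natCast]
  obtain ⟨m, rfl | rfl⟩ := k.even_or_odd'
  · rw [tauAux_even, matJ_discrete hb]
    have hdet : ∀ f : Fin (2 * m) → Fin N, ((momentMatrix ζ b l (2 * m)).submatrix id f).det =
        (∏ i, b (f i) * ζ (f i) ^ l) * ∏ i, ∏ j ∈ Ioi i, (ζ (f j) - ζ (f i)) := by
      intro f
      rw [← det_of_mul_pow (fun j => b j * ζ j ^ l)]
      congr 1
      ext p i
      simp only [momentMatrix, Matrix.submatrix_apply, Matrix.of_apply, id]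
      rw [zpow_add₀ (hp _).ne', zpow_natCast, mul_assoc]
    have hpr : ∀ f : Fin (2 * m) → Fin N, 0 < ∏ i, b (f i) * ζ (f i) ^ l := fun f =>
      prod_pos fun i _ => mul_pos (hb _) (zpow_pos (hp _) _)
    refine pfaffian_schur_pos hζ.injective (fun i j _ => add_pos (hp i) (hp j)) _
      (fun f _ => ⟨_, (hpr f).le, hdet f⟩) ⟨Fin.castLE hk, Fin.castLE_injective hk, ?_⟩
    rw [hdet]
    refine mul_ne_zero (hpr _).ne' ?_
    refine prod_ne_zero_iff.2 fun i _ => prod_ne_zero_iff.2 fun j hj => sub_ne_zero.2 ?_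
    exact hζ.injective.ne ((Fin.castLE_injective hk).ne (mem_Ioi.1 hj).ne')
  · rw [tauAux_odd]
    refine lt_of_lt_of_eq ?_
      (congrArg (pfaffian (m + 1)) (border_discrete hp hb l (2 * m + 1))).symm
    set x : Fin (N + 1) → ℝ := Fin.cons 0 ζ
    have hx : StrictMono x := by
      intro i j
      refine Fin.cases ?_ (fun j => ?_) j
      · intro h; exact absurd h (Fin.not_lt_zero _)
      refine Fin.cases ?_ (fun i => ?_) i
      · intro _; exact hp j
      · intro h; exact hζ (Fin.succ_lt_succ_iff.1 h)
    have hx0 : ∀ i, 0 ≤ x i := fun i => Fin.cases le_rfl (fun i => (hp i).le) i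
    have hpr : ∀ f : Fin (2 * m + 1 + 1) → Fin (N + 1), 0 <
        ∏ i, (Fin.cons 1 (fun j => b j * ζ j ^ (l - 1)) : Fin (N + 1) → ℝ) (f i) := by
      refine fun f => prod_pos fun i _ => ?_
      generalize f i = a
      refine Fin.cases one_pos (fun j => mul_pos (hb j) (zpow_pos (hp j) _)) a
    have hk' : 2 * m + 1 + 1 ≤ N + 1 := by omega
    refine pfaffian_schur_pos (m := m + 1) hx.injective ?_ _ ?_
      ⟨(Fin.castLE hk' : Fin (2 * m + 1 + 1) → Fin (N + 1)), Fin.castLE_injective hk', ?_⟩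
    · intro i j hij
      rcases lt_or_gt_of_ne hij with h | h
      · have := hx h
        have := hx0 i
        linarith
      · have := hx h
        have := hx0 j
        linarith
    · intro f hf
      by_cases h0 : ∃ i, f i = 0
      · obtain ⟨i₀, hi₀⟩ := h0
        exact ⟨_, (hpr f).le, det_borderedMomentMatrix hp l f hf hi₀⟩
      -- Without the node 0 the first row of the selected minor is zero, so the constant 0 serves.
      · push Not at h0
        refine ⟨0, le_rfl, ?_⟩
        rw [zero_mul]
        refine Matrix.det_eq_zero_of_row_eq_zero (0 : Fin (2 * m + 1 + 1)) fun i => ?_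
        obtain ⟨j, hj⟩ := Fin.exists_succ_eq.2 (h0 i)
        simp [borderedMomentMatrix, ← hj]
    · have := det_borderedMomentMatrix (b := b) hp l (Fin.castLE hk') (Fin.castLE_injective hk')
        (i₀ := 0) rfl
      refine ne_of_eq_of_ne this (mul_ne_zero (hpr _).ne' ?_)
      refine prod_ne_zero_iff.2 fun i _ => prod_ne_zero_iff.2 fun j hj => sub_ne_zero.2 ?_
      exact hx.injective.ne ((Fin.castLE_injective hk').ne (mem_Ioi.1 hj).ne')

end discrete

/-! ### The two maps on the phase space -/

lemma sum_Iic_sub {N : ℕ} (P : ℕ → ℝ) (i : Fin N) :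
    ∑ j ∈ Iic i, (P (j + 1) - P j) = P (i + 1) - P 0 := by
  rw [← Finset.sum_range_sub P (i + 1), ← Nat.Iio_eq_range]
  have : Iio ((i : ℕ) + 1) = (Iic i).map Fin.valEmbedding := by
    rw [Fin.map_valEmbedding_Iic]
    ext; simp
  rw [this, sum_map]
  rfl

lemma sum_Ici_sub {N : ℕ} (P : ℕ → ℝ) (i : Fin N) :
    ∑ j ∈ Ici i, (P j - P (j + 1)) = P i - P N := by
  have h1 := sum_Iic_sub (fun n => -P n) i
  have h2 : ∑ j : Fin N, (P j - P (j + 1)) = P 0 - P N := by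
    rw [Fin.sum_univ_eq_sum_range (fun j => P j - P (j + 1)), Finset.sum_range_sub']
  have h3 : (univ : Finset (Fin N)) = Iio i ∪ Ici i := by
    ext j; simp [lt_or_ge]
  have h4 : Iic i = insert i (Iio i) := by
    ext j; simp [le_iff_eq_or_lt]
  rw [h4, sum_insert (by simp)] at h1
  rw [h3, sum_union (by
    rw [disjoint_left]; intro j; simp)] at h2
  have h5 : ∑ j ∈ Iio i, (-P (j + 1) - -P j) = ∑ j ∈ Iio i, (P j - P (j + 1)) :=
    sum_congr rfl fun j _ => by ring
  rw [h5] at h1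
  linarith

section maps

variable {N : ℕ} {d : Data N}

lemma sum_exp_pos (hd : d ∈ phaseSpace N) (k : Fin N) :
    0 < ∑ j ∈ Iic k, d.2 j * Real.exp (2 * d.1 j) :=
  sum_pos (fun j _ => mul_pos (hd.2 j) (Real.exp_pos _)) ⟨k, by simp⟩

lemma exp_two_mul_xmToYn (hd : d ∈ phaseSpace N) (k : Fin N) :
    Real.exp (2 * (xmToYn d).1 k) = ∑ j ∈ Iic k, d.2 j * Real.exp (2 * d.1 j) := by
  have : 2 * (xmToYn d).1 k = Real.log (∑ j ∈ Iic k, d.2 j * Real.exp (2 * d.1 j)) := by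
    simp only [xmToYn]; ring
  rw [this, Real.exp_log (sum_exp_pos hd k)]

/-- `e^{-x_k}`, with value `0` past the last peakon. -/
def expNeg (d : Data N) (n : ℕ) : ℝ := if h : n < N then Real.exp (-d.1 ⟨n, h⟩) else 0

lemma expNeg_val (d : Data N) (k : Fin N) : expNeg d k = Real.exp (-d.1 k) := by
  simp [expNeg]

lemma xmToYn_snd (d : Data N) (k : Fin N) :
    (xmToYn d).2 k = (expNeg d k - expNeg d (k + 1)) * Real.exp ((xmToYn d).1 k) := by
  rw [expNeg_val]
  rfl

lemma xmToYn_mem_phaseSpace (hd : d ∈ phaseSpace N) : xmToYn d ∈ phaseSpace N := by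
  constructor
  · intro i j hij
    have h : ∑ l ∈ Iic i, d.2 l * Real.exp (2 * d.1 l) <
        ∑ l ∈ Iic j, d.2 l * Real.exp (2 * d.1 l) := by
      refine sum_lt_sum_of_subset (i := j) (Iic_subset_Iic.2 hij.le) (by simp) (by simpa using hij)
        (mul_pos (hd.2 j) (Real.exp_pos _)) fun l _ _ => (mul_pos (hd.2 l) (Real.exp_pos _)).le
    have := Real.log_lt_log (sum_exp_pos hd i) h
    simp only [xmToYn]
    linarith
  · intro k
    rw [xmToYn_snd]
    refine mul_pos (sub_pos.2 ?_) (Real.exp_pos _)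
    rw [expNeg_val, expNeg]
    split_ifs with h
    · have : d.1 k < d.1 ⟨k + 1, h⟩ := hd.1 (by simp [Fin.lt_def])
      exact Real.exp_lt_exp.2 (by linarith)
    · exact Real.exp_pos _

/-- Since m̃_j e^{-x̃_j} = e^{-x_j} - e^{-x_{j+1}}, the sum in Ψ telescopes to e^{-x_k}; and
e^{2x̃_k} are the partial sums of m_j e^{2x_j}, whose increments return m_k. -/
theorem ynToXm_xmToYn (hd : d ∈ phaseSpace N) : ynToXm (xmToYn d) = d := by
  have h1 : (ynToXm (xmToYn d)).1 = d.1 := by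
    funext k
    have h : ∑ j ∈ Ici k, (xmToYn d).2 j * Real.exp (-(xmToYn d).1 j) = Real.exp (-d.1 k) := by
      have h2 := sum_Ici_sub (expNeg d) k
      rw [expNeg_val, show expNeg d N = 0 by simp [expNeg], sub_zero] at h2
      rw [← h2]
      refine sum_congr rfl fun j _ => ?_
      rw [xmToYn_snd, mul_assoc, ← Real.exp_add]
      simp
    simp only [ynToXm]
    rw [h, Real.log_exp, neg_neg]
  refine Prod.ext h1 (funext fun k => ?_)
  have h2 : (ynToXm (xmToYn d)).2 k = (Real.exp (2 * (xmToYn d).1 k) -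
      if 0 < (k : ℕ) then Real.exp (2 * (xmToYn d).1 ⟨k - 1, by omega⟩) else 0) *
      Real.exp (-2 * (ynToXm (xmToYn d)).1 k) := rfl
  have h3 : (if 0 < (k : ℕ) then Real.exp (2 * (xmToYn d).1 ⟨k - 1, by omega⟩) else 0) =
      ∑ j ∈ Iio k, d.2 j * Real.exp (2 * d.1 j) := by
    split_ifs with h
    · rw [exp_two_mul_xmToYn hd]
      congr 1
      ext j
      simp only [mem_Iic, mem_Iio, Fin.le_def, Fin.lt_def]
      omega
    · rw [show Iio k = ∅ by
        ext j
        simp only [mem_Iio, Fin.lt_def, notMem_empty, iff_false]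
        omega, sum_empty]
  have h4 : Iic k = insert k (Iio k) := by
    ext j; simp [le_iff_eq_or_lt]
  rw [h2, h3, h1, exp_two_mul_xmToYn hd, h4, sum_insert (by simp), add_sub_cancel_right, mul_assoc,
    ← Real.exp_add]
  simp

end maps

/-! ### The explicit formulae -/

section formulae

variable {N : ℕ} {ζ b : Fin N → ℝ}

lemma tau_neg_one (μ : Measure ℝ) (l : ℤ) : tau μ l (-1) = 0 := rfl

/-- The Pfaffian bilinear expression for `F_k^{(l+1,l+1)}`, including `k = 0`. -/
theorem tau_mul_tau_sub (hζ : StrictMono ζ) (hp : ∀ j, 0 < ζ j) (hb : ∀ j, 0 < b j) (l : ℤ)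
    {k : ℕ} (hk : k ≤ N) :
    tau (discreteMeasure ζ b) (l + 1) k * tau (discreteMeasure ζ b) l k - tau (discreteMeasure ζ b) (l + 1) (k - 1) * tau (discreteMeasure ζ b) l (k + 1) =
      2 ^ k * F (discreteMeasure ζ b) (l + 1) (l + 1) k := by
  cases k with
  | zero =>
    have : ((0 : ℕ) : ℤ) - 1 = -1 := by simp
    rw [this, tau_neg_one]
    simp [tau_zero, F_zero]
  | succ k =>
    rw [(momentRelations_discrete hp hb).two_pow_mul_F_diag l k (tau_pos hζ hp hb _ (by omega)).ne'
      (tau_pos hζ hp hb _ hk).ne']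
    congr 3
    simp

theorem W_eq (hζ : StrictMono ζ) (hp : ∀ j, 0 < ζ j) (hb : ∀ j, 0 < b j) {k : ℕ} (hk : k ≤ N) :
    W (discreteMeasure ζ b) k = 2 ^ k * F (discreteMeasure ζ b) 1 1 k := by
  have := tau_mul_tau_sub hζ hp hb 0 hk
  rw [zero_add] at this
  exact this

theorem Z_eq (hζ : StrictMono ζ) (hp : ∀ j, 0 < ζ j) (hb : ∀ j, 0 < b j) {k : ℕ} (hk : k ≤ N) :
    Z (discreteMeasure ζ b) k = 2 ^ k * F (discreteMeasure ζ b) 0 0 k := by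
  have := tau_mul_tau_sub hζ hp hb (-1) hk
  rw [neg_add_cancel] at this
  rw [← this, Z]
  ring

lemma F_one_zero_eq (hp : ∀ j, 0 < ζ j) (hb : ∀ j, 0 < b j) (k : ℕ) :
    F (discreteMeasure ζ b) 1 0 k = tau (discreteMeasure ζ b) 0 k ^ 2 / 2 ^ k := by
  have := (momentRelations_discrete hp hb).two_pow_mul_F 0 k
  rw [zero_add] at this
  rw [← this]
  field_simp

lemma F_two_one_eq (hp : ∀ j, 0 < ζ j) (hb : ∀ j, 0 < b j) (k : ℕ) :
    F (discreteMeasure ζ b) 2 1 k = tau (discreteMeasure ζ b) 1 k ^ 2 / 2 ^ k := by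
  have := (momentRelations_discrete hp hb).two_pow_mul_F 1 k
  rw [one_add_one_eq_two] at this
  rw [← this]
  field_simp

lemma G_eq (hp : ∀ j, 0 < ζ j) (hb : ∀ j, 0 < b j) (k : ℕ) :
    G (discreteMeasure ζ b) 0 2 (k + 1 : ℕ) = tau (discreteMeasure ζ b) 0 (k + 1 : ℕ) * tau (discreteMeasure ζ b) 1 k / 2 ^ k := by
  have := (momentRelations_discrete hp hb).two_pow_mul_G 0 k
  rw [zero_add, zero_add] at this
  rw [← this]
  field_simp

lemma index_eq (i : Fin N) : (N : ℤ) - (i : ℕ) = ((N - 1 - i : ℕ) + 1 : ℕ) := by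
  have := i.2
  omega

lemma dpFormula_fst (hζ : StrictMono ζ) (hp : ∀ j, 0 < ζ j) (hb : ∀ j, 0 < b j) (i : Fin N) :
    (dpFormula N (discreteMeasure ζ b)).1 i =
      Real.log (tau (discreteMeasure ζ b) 0 ((N - 1 - i : ℕ) + 1 : ℕ) / tau (discreteMeasure ζ b) 1 (N - 1 - i : ℕ)) := by
  have h0 := tau_pos hζ hp hb 0 (k := (N - 1 - i : ℕ) + 1) (by omega)
  have h1 := tau_pos hζ hp hb 1 (k := N - 1 - i) (by omega)
  simp only [dpFormula, index_eq]
  rw [F_one_zero_eq hp hb, G_eq hp hb]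
  congr 1
  field_simp
  ring

lemma dpFormula_snd (i : Fin N) :
    (dpFormula N (discreteMeasure ζ b)).2 i = G (discreteMeasure ζ b) 0 2 ((N - 1 - i : ℕ) + 1 : ℕ) ^ 2 /
      (2 * F (discreteMeasure ζ b) 1 1 ((N - 1 - i : ℕ) + 1 : ℕ) * F (discreteMeasure ζ b) 1 1 (N - 1 - i : ℕ)) := by
  simp only [dpFormula, index_eq]
  congr 3
  simp

lemma exp_dpFormula (hζ : StrictMono ζ) (hp : ∀ j, 0 < ζ j) (hb : ∀ j, 0 < b j) (i : Fin N) :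
    Real.exp ((dpFormula N (discreteMeasure ζ b)).1 i) =
      tau (discreteMeasure ζ b) 0 ((N - 1 - i : ℕ) + 1 : ℕ) / tau (discreteMeasure ζ b) 1 (N - 1 - i : ℕ) := by
  have h0 := tau_pos hζ hp hb 0 (k := (N - 1 - i : ℕ) + 1) (by omega)
  have h1 := tau_pos hζ hp hb 1 (k := N - 1 - i) (by omega)
  rw [dpFormula_fst hζ hp hb, Real.exp_log (div_pos h0 h1)]

/-- `m_k e^{2 x_k}` as a difference. -/
lemma dpFormula_snd_mul_exp (hζ : StrictMono ζ) (hp : ∀ j, 0 < ζ j) (hb : ∀ j, 0 < b j)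
    (i : Fin N) :
    (dpFormula N (discreteMeasure ζ b)).2 i * Real.exp (2 * (dpFormula N (discreteMeasure ζ b)).1 i) =
      2 * F (discreteMeasure ζ b) 0 0 (N - (i + 1) + 1 : ℕ) / F (discreteMeasure ζ b) 1 1 (N - (i + 1) : ℕ) -
        2 * F (discreteMeasure ζ b) 0 0 (N - i + 1 : ℕ) / F (discreteMeasure ζ b) 1 1 (N - i : ℕ) := by
  obtain ⟨n, hn⟩ : ∃ n, N - 1 - (i : ℕ) = n := ⟨_, rfl⟩
  have e1 : N - (i + 1 : ℕ) = n := by omega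
  have e2 : N - (i : ℕ) = n + 1 := by omega
  rw [two_mul (_ : ℝ), Real.exp_add, exp_dpFormula hζ hp hb, dpFormula_snd, hn, e1, e2,
    G_eq hp hb]
  have h0 := tau_pos hζ hp hb 0 (k := n + 1) (by omega)
  have h1 := tau_pos hζ hp hb 1 (k := n) (by omega)
  have h2 := F_diag_pos hζ hp hb 1 (k := n + 1) (by omega)
  have h3 := F_diag_pos hζ hp hb 1 (k := n) (by omega)
  -- In terms of τ the left side is 2 (F^{(1,0)})² over the product of the two F^{(1,1)}; this
  -- identity turns the numerator into the cross difference.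
  have hd := (momentRelations_discrete hp hb).F_desnanot 0 n
  rw [zero_add, F_one_zero_eq hp hb] at hd
  have e3 : n + 1 + 1 = n + 2 := rfl
  rw [e3, div_sub_div _ _ h3.ne' h2.ne']
  have hd' : 2 * F (discreteMeasure ζ b) 0 0 (n + 1 : ℕ) * F (discreteMeasure ζ b) 1 1 (n + 1 : ℕ) -
      F (discreteMeasure ζ b) 1 1 n * (2 * F (discreteMeasure ζ b) 0 0 (n + 2 : ℕ)) =
        2 * (tau (discreteMeasure ζ b) 0 (n + 1 : ℕ) ^ 2 / 2 ^ (n + 1)) ^ 2 := by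
    linear_combination -2 * hd
  rw [hd', pow_succ (2 : ℝ)]
  field_simp

lemma expNeg_dpFormula (hζ : StrictMono ζ) (hp : ∀ j, 0 < ζ j) (hb : ∀ j, 0 < b j) {n : ℕ}
    (hn : n ≤ N) : expNeg (dpFormula N (discreteMeasure ζ b)) n =
      tau (discreteMeasure ζ b) 1 ((N : ℤ) - n - 1) / tau (discreteMeasure ζ b) 0 ((N : ℤ) - n) := by
  rw [expNeg]
  split_ifs with h
  · rw [Real.exp_neg, exp_dpFormula hζ hp hb, inv_div]
    congr 2 <;> simp <;> omega
  -- Past the last peakon the quotient has numerator τ_{-1} = 0, matching x_{N+1} = ∞.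
  · have e : (N : ℤ) - n - 1 = -1 := by omega
    rw [e, tau_neg_one, zero_div]

lemma W_pos (hζ : StrictMono ζ) (hp : ∀ j, 0 < ζ j) (hb : ∀ j, 0 < b j) {k : ℕ} (hk : k ≤ N) :
    0 < W (discreteMeasure ζ b) k := by
  rw [W_eq hζ hp hb hk]
  exact mul_pos (by positivity) (F_diag_pos hζ hp hb _ hk)

lemma Z_pos (hζ : StrictMono ζ) (hp : ∀ j, 0 < ζ j) (hb : ∀ j, 0 < b j) {k : ℕ} (hk : k ≤ N) :
    0 < Z (discreteMeasure ζ b) k := by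
  rw [Z_eq hζ hp hb hk]
  exact mul_pos (by positivity) (F_diag_pos hζ hp hb _ hk)

lemma expNeg_dpFormula_sub (hζ : StrictMono ζ) (hp : ∀ j, 0 < ζ j) (hb : ∀ j, 0 < b j)
    (i : Fin N) :
    expNeg (dpFormula N (discreteMeasure ζ b)) i - expNeg (dpFormula N (discreteMeasure ζ b)) (i + 1) =
      W (discreteMeasure ζ b) (N - 1 - i : ℕ) / (U (discreteMeasure ζ b) ((N - 1 - i : ℕ) + 1 : ℕ) * U (discreteMeasure ζ b) (N - 1 - i : ℕ)) := by
  rw [expNeg_dpFormula hζ hp hb i.2.le, expNeg_dpFormula hζ hp hb i.2]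
  obtain ⟨n, hn⟩ : ∃ n, N - 1 - (i : ℕ) = n := ⟨_, rfl⟩
  have e1 : (N : ℤ) - (i : ℕ) - 1 = n := by omega
  have e2 : (N : ℤ) - (i : ℕ) = (n + 1 : ℕ) := by omega
  have e3 : (N : ℤ) - ((i : ℕ) + 1 : ℕ) - 1 = n - 1 := by omega
  have e4 : (N : ℤ) - ((i : ℕ) + 1 : ℕ) = n := by omega
  rw [e3, e4, e1, e2, hn]
  have h0 := tau_pos hζ hp hb 0 (k := n + 1) (by omega)
  have h1 := tau_pos hζ hp hb 0 (k := n) (by omega)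
  rw [div_sub_div _ _ h0.ne' h1.ne']
  simp only [U, W]
  congr 1
  push_cast
  ring

/-- The ordering of the positions amounts to positivity of W, the numerator of e^{-x_i} -
e^{-x_{i+1}}. -/
lemma dpFormula_mem_phaseSpace (hζ : StrictMono ζ) (hp : ∀ j, 0 < ζ j) (hb : ∀ j, 0 < b j) :
    dpFormula N (discreteMeasure ζ b) ∈ phaseSpace N := by
  constructor
  · have key : ∀ (i j : Fin N), (j : ℕ) = i + 1 →
      (dpFormula N (discreteMeasure ζ b)).1 i < (dpFormula N (discreteMeasure ζ b)).1 j := by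
      intro i j hij
      have h1 := expNeg_dpFormula_sub hζ hp hb i
      rw [← hij, expNeg_val, expNeg_val] at h1
      have h2 : 0 < W (discreteMeasure ζ b) (N - 1 - i : ℕ) /
          (U (discreteMeasure ζ b) ((N - 1 - i : ℕ) + 1 : ℕ) * U (discreteMeasure ζ b) (N - 1 - i : ℕ)) :=
        div_pos (W_pos hζ hp hb (by omega)) (mul_pos (tau_pos hζ hp hb 0 (by omega))
          (tau_pos hζ hp hb 0 (by omega)))
      rw [← h1, sub_pos, Real.exp_lt_exp] at h2
      linarith
    cases N with
    | zero => intro i; exact i.elim0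
    | succ N => exact Fin.strictMono_iff_lt_succ.2 fun i => key _ _ (by simp)
  · intro i
    rw [dpFormula_snd, G_eq hp hb]
    have h0 := tau_pos hζ hp hb 0 (k := (N - 1 - i : ℕ) + 1) (by omega)
    have h1 := tau_pos hζ hp hb 1 (k := N - 1 - i) (by omega)
    have h2 := F_diag_pos hζ hp hb 1 (k := N - 1 - i + 1) (by omega)
    have h3 := F_diag_pos hζ hp hb 1 (k := N - 1 - i) (by omega)
    positivity

theorem xmToYn_dpFormula (hζ : StrictMono ζ) (hp : ∀ j, 0 < ζ j) (hb : ∀ j, 0 < b j) :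
    xmToYn (dpFormula N (discreteMeasure ζ b)) = nvFormula N (discreteMeasure ζ b) := by
  have hidx : ∀ i : Fin N, (((N - 1 - i : ℕ) + 1 : ℕ) : ℤ) - 1 = (N - 1 - i : ℕ) := by
    intro i; simp
  have h1 : (xmToYn (dpFormula N (discreteMeasure ζ b))).1 = (nvFormula N (discreteMeasure ζ b)).1 := by
    funext i
    simp only [xmToYn, nvFormula, index_eq]
    congr 2
    rw [sum_congr rfl fun j _ => dpFormula_snd_mul_exp hζ hp hb j,
      sum_Iic_sub (fun n => 2 * F (discreteMeasure ζ b) 0 0 (N - n + 1 : ℕ) / F (discreteMeasure ζ b) 1 1 (N - n : ℕ)) i]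
    -- The lower end of the telescoping sum carries F_{N+1}^{(0,0)} = 0; the upper end is Z_k /
    -- W_{k-1}, the surplus factor 2 being 2^k / 2^{k-1}.
    rw [Nat.sub_zero, F_diag_eq_zero hb, mul_zero, zero_div, sub_zero, hidx,
      Z_eq hζ hp hb (by omega), W_eq hζ hp hb (by omega),
      show N - (i + 1 : ℕ) = N - 1 - i by omega]
    have h3 := F_diag_pos hζ hp hb 1 (k := N - 1 - i) (by omega)
    rw [pow_succ]
    field_simp
  refine Prod.ext h1 (funext fun i => ?_)
  rw [xmToYn_snd, h1, expNeg_dpFormula_sub hζ hp hb]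
  simp only [nvFormula, index_eq]
  rw [hidx]
  have hW := W_pos hζ hp hb (k := N - 1 - i) (by omega)
  have hZ := Z_pos hζ hp hb (k := N - 1 - i + 1) (by omega)
  generalize W (discreteMeasure ζ b) (N - 1 - i : ℕ) = w at *
  generalize Z (discreteMeasure ζ b) (N - 1 - i + 1 : ℕ) = z at *
  have h2 : Real.exp (1 / 2 * Real.log (z / w)) = Real.sqrt (z * w) / w := by
    rw [one_div_mul_eq_div, ← Real.log_sqrt (div_pos hZ hW).le,
      Real.exp_log (Real.sqrt_pos.2 (div_pos hZ hW)), Real.sqrt_div hZ.le, Real.sqrt_mul hZ.le,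
      mul_div_assoc, Real.sqrt_div_self, div_eq_mul_inv]
  rw [h2]
  field_simp

theorem ynToXm_nvFormula (hζ : StrictMono ζ) (hp : ∀ j, 0 < ζ j) (hb : ∀ j, 0 < b j) :
    ynToXm (nvFormula N (discreteMeasure ζ b)) = dpFormula N (discreteMeasure ζ b) := by
  rw [← xmToYn_dpFormula hζ hp hb, ynToXm_xmToYn (dpFormula_mem_phaseSpace hζ hp hb)]

end formulae

/-! ### Trajectories -/

lemma eq_mul_exp_of_hasDerivAt {f : ℝ → ℝ} {z : ℝ} (h : ∀ t, HasDerivAt f (f t / z) t) (t : ℝ) :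
    f t = f 0 * Real.exp (t / z) := by
  have h1 : ∀ s, HasDerivAt (fun s => f s * Real.exp (-(s / z))) 0 s := by
    intro s
    have h2 : HasDerivAt (fun s : ℝ => -(s / z)) (-(1 / z)) s := ((hasDerivAt_id s).div_const z).neg
    exact ((h s).mul h2.exp).congr_deriv (by ring)
  have h3 := is_const_of_deriv_eq_zero (fun s => (h1 s).differentiableAt) (fun s => (h1 s).deriv) t 0
  simp only [zero_div, neg_zero, Real.exp_zero, mul_one] at h3
  rw [← h3, mul_assoc, ← Real.exp_add]
  simp

lemma hasDerivAt_of_eq_mul_exp {f : ℝ → ℝ} {z : ℝ} (h : ∀ t, f t = f 0 * Real.exp (t / z))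
    (t : ℝ) : HasDerivAt f (f t / z) t := by
  have h2 : HasDerivAt (fun s : ℝ => s / z) (1 / z) t := (hasDerivAt_id t).div_const z
  have h3 := h2.exp.const_mul (f 0)
  rw [← funext h] at h3
  exact h3.congr_deriv (by rw [h t]; ring)

/-- Solving the linear equation for b_j gives both sets of trajectories the same parameter curves,
so the fixed-time identities transfer with the same ζ and b. -/
lemma mem_dpExplicit {N : ℕ} {c : ℝ → Data N} : c ∈ dpExplicit N ↔
    ∃ (ζ : Fin N → ℝ) (b : ℝ → Fin N → ℝ),
      StrictMono ζ ∧ (∀ j, 0 < ζ j) ∧ (∀ t j, 0 < b t j) ∧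
      (∀ t j, b t j = b 0 j * Real.exp (t / ζ j)) ∧
      ∀ t, c t = dpFormula N (discreteMeasure ζ (b t)) := by
  constructor
  · rintro ⟨ζ, b, h1, h2, h3, h4, h5⟩
    exact ⟨ζ, b, h1, h2, h3, fun t j => eq_mul_exp_of_hasDerivAt (fun t => h4 t j) t, h5⟩
  · rintro ⟨ζ, b, h1, h2, h3, h4, h5⟩
    exact ⟨ζ, b, h1, h2, h3, fun t j => hasDerivAt_of_eq_mul_exp (fun t => h4 t j) t, h5⟩

lemma mapsTo_xmToYn (N : ℕ) : Set.MapsTo (fun (c : ℝ → Data N) t => xmToYn (c t))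
    (dpExplicit N) (nvExplicit N) := by
  intro c hc
  obtain ⟨ζ, b, h1, h2, h3, h4, h5⟩ := mem_dpExplicit.1 hc
  exact ⟨ζ, b, h1, h2, h3, h4, fun t => by
    simp only [h5]
    exact xmToYn_dpFormula h1 h2 (h3 t)⟩

lemma mapsTo_ynToXm (N : ℕ) : Set.MapsTo (fun (c : ℝ → Data N) t => ynToXm (c t))
    (nvExplicit N) (dpExplicit N) := by
  rintro c ⟨ζ, b, h1, h2, h3, h4, h5⟩
  exact mem_dpExplicit.2 ⟨ζ, b, h1, h2, h3, h4, fun t => by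
    simp only [h5]
    exact ynToXm_nvFormula h1 h2 (h3 t)⟩

lemma invOn_explicit (N : ℕ) : Set.InvOn (fun (c : ℝ → Data N) t => ynToXm (c t))
    (fun (c : ℝ → Data N) t => xmToYn (c t)) (dpExplicit N) (nvExplicit N) := by
  constructor
  · rintro c ⟨ζ, b, h1, h2, h3, h4, h5⟩
    funext t
    simp only [h5]
    rw [xmToYn_dpFormula h1 h2 (h3 t), ynToXm_nvFormula h1 h2 (h3 t)]
  · rintro c ⟨ζ, b, h1, h2, h3, h4, h5⟩
    funext t
    simp only [h5]
    rw [ynToXm_nvFormula h1 h2 (h3 t), xmToYn_dpFormula h1 h2 (h3 t)]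

end Peakon

end

/-! ### Assembly of positivity, equivalent forms and bijections -/

theorem mainTheorem9 (N : ℕ) :
    (∀ (ζ b : Fin N → ℝ) (μ : MeasureTheory.Measure ℝ),
      StrictMono ζ → (∀ j, 0 < ζ j) → (∀ j, 0 < b j) → μ = Peakon.discreteMeasure ζ b →
      -- the quantities in the formulae are positive
      (∀ k : ℤ, 0 ≤ k → k ≤ N →
        0 < Peakon.F μ 1 0 k ∧ 0 < Peakon.F μ 1 1 k ∧ 0 < Peakon.F μ 2 1 k ∧
        0 < Peakon.tau μ 0 k ∧ 0 < Peakon.tau μ 1 k ∧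
        0 < Peakon.U μ k ∧ 0 < Peakon.W μ k ∧ 0 < Peakon.Z μ k) ∧
      (∀ k : ℤ, 1 ≤ k → k ≤ N → 0 < Peakon.G μ 0 2 k) ∧
      -- the Pfaffian expressions `W_k`, `Z_k` are determinants
      (∀ k : ℤ, 0 ≤ k → k ≤ N →
        Peakon.W μ k = 2 ^ k * Peakon.F μ 1 1 k ∧ Peakon.Z μ k = 2 ^ k * Peakon.F μ 0 0 k) ∧
      -- all the forms of the Degasperis-Procesi formulae agree
      (∀ (i : Fin N) (k : ℤ), k = (N : ℤ) - (i : ℕ) →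
        (Peakon.dpFormula N μ).1 i = Real.log (2 * Peakon.F μ 1 0 k / Peakon.G μ 0 2 k) ∧
        (Peakon.dpFormula N μ).1 i = Real.log (Peakon.G μ 0 2 k / Peakon.F μ 2 1 (k - 1)) ∧
        (Peakon.dpFormula N μ).1 i =
          1 / 2 * Real.log (2 * Peakon.F μ 1 0 k / Peakon.F μ 2 1 (k - 1)) ∧
        (Peakon.dpFormula N μ).1 i = Real.log (Peakon.tau μ 0 k / Peakon.tau μ 1 (k - 1)) ∧
        (Peakon.dpFormula N μ).2 i =
          Peakon.G μ 0 2 k ^ 2 / (2 * Peakon.F μ 1 1 k * Peakon.F μ 1 1 (k - 1)) ∧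
        (Peakon.dpFormula N μ).2 i =
          Peakon.F μ 1 0 k * Peakon.F μ 2 1 (k - 1) /
            (Peakon.F μ 1 1 k * Peakon.F μ 1 1 (k - 1))) ∧
      -- the formulae give points of the phase spaces
      Peakon.dpFormula N μ ∈ Peakon.phaseSpace N ∧
      Peakon.nvFormula N μ ∈ Peakon.phaseSpace N ∧
      -- substitution turns the formulae into each other
      Peakon.xmToYn (Peakon.dpFormula N μ) = Peakon.nvFormula N μ ∧
      Peakon.ynToXm (Peakon.nvFormula N μ) = Peakon.dpFormula N μ) ∧
    -- the two maps are mutually inverse bijections between the explicit trajectories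
    Set.BijOn (fun (c : ℝ → Peakon.Data N) t => Peakon.xmToYn (c t))
      (Peakon.dpExplicit N) (Peakon.nvExplicit N) ∧
    Set.BijOn (fun (c : ℝ → Peakon.Data N) t => Peakon.ynToXm (c t))
      (Peakon.nvExplicit N) (Peakon.dpExplicit N) ∧
    Set.InvOn (fun (c : ℝ → Peakon.Data N) t => Peakon.ynToXm (c t))
      (fun (c : ℝ → Peakon.Data N) t => Peakon.xmToYn (c t))
      (Peakon.dpExplicit N) (Peakon.nvExplicit N) := by

  refine ⟨?_, (Peakon.invOn_explicit N).bijOn (Peakon.mapsTo_xmToYn N) (Peakon.mapsTo_ynToXm N),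
    (Peakon.invOn_explicit N).symm.bijOn (Peakon.mapsTo_ynToXm N) (Peakon.mapsTo_xmToYn N),
    Peakon.invOn_explicit N⟩
  rintro ζ b μ hζ hp hb rfl
  refine ⟨?_, ?_, ?_, ?_, Peakon.dpFormula_mem_phaseSpace hζ hp hb, ?_,
    Peakon.xmToYn_dpFormula hζ hp hb, Peakon.ynToXm_nvFormula hζ hp hb⟩
  · intro k hk0 hkN
    lift k to ℕ using hk0
    have hk : k ≤ N := by exact_mod_cast hkN
    have h0 := Peakon.tau_pos hζ hp hb 0 hk
    have h1 := Peakon.tau_pos hζ hp hb 1 hk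
    refine ⟨?_, Peakon.F_diag_pos hζ hp hb 1 hk, ?_, h0, h1, h0, Peakon.W_pos hζ hp hb hk,
      Peakon.Z_pos hζ hp hb hk⟩
    · rw [Peakon.F_one_zero_eq hp hb]
      positivity
    · rw [Peakon.F_two_one_eq hp hb]
      positivity
  · intro k hk1 hkN
    obtain ⟨n, rfl⟩ : ∃ n : ℕ, k = (n + 1 : ℕ) := ⟨(k - 1).toNat, by omega⟩
    have h0 := Peakon.tau_pos hζ hp hb 0 (k := n + 1) (by omega)
    have h1 := Peakon.tau_pos hζ hp hb 1 (k := n) (by omega)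
    rw [Peakon.G_eq hp hb]
    positivity
  · intro k hk0 hkN
    lift k to ℕ using hk0
    have hk : k ≤ N := by exact_mod_cast hkN
    rw [zpow_natCast]
    exact ⟨Peakon.W_eq hζ hp hb hk, Peakon.Z_eq hζ hp hb hk⟩
  · intro i k hk
    have hx : (Peakon.dpFormula N (Peakon.discreteMeasure ζ b)).1 i = Real.log
        (2 * Peakon.F (Peakon.discreteMeasure ζ b) 1 0 k /
          Peakon.G (Peakon.discreteMeasure ζ b) 0 2 k) := by
      subst hk; rfl
    have hm : (Peakon.dpFormula N (Peakon.discreteMeasure ζ b)).2 i =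
        Peakon.G (Peakon.discreteMeasure ζ b) 0 2 k ^ 2 /
          (2 * Peakon.F (Peakon.discreteMeasure ζ b) 1 1 k *
            Peakon.F (Peakon.discreteMeasure ζ b) 1 1 (k - 1)) := by
      subst hk; rfl
    obtain ⟨n, rfl⟩ : ∃ n : ℕ, k = (n + 1 : ℕ) := ⟨(k - 1).toNat, by omega⟩
    have hn : n + 1 ≤ N := by omega
    have e : ((n + 1 : ℕ) : ℤ) - 1 = n := by simp
    have h0 := Peakon.tau_pos hζ hp hb 0 hn
    have h1 := Peakon.tau_pos hζ hp hb 1 (k := n) (by omega)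
    have h2 := Peakon.F_diag_pos hζ hp hb 1 hn
    have h3 := Peakon.F_diag_pos hζ hp hb 1 (k := n) (by omega)
    refine ⟨hx, ?_, ?_, ?_, hm, ?_⟩
    · rw [hx, e, Peakon.F_one_zero_eq hp hb, Peakon.F_two_one_eq hp hb, Peakon.G_eq hp hb]
      congr 1
      field_simp
      ring
    · rw [hx, e, Peakon.F_one_zero_eq hp hb, Peakon.F_two_one_eq hp hb, Peakon.G_eq hp hb,
        one_div_mul_eq_div, ← Real.log_sqrt (by positivity)]
      congr 1
      symm
      rw [Real.sqrt_eq_iff_mul_self_eq_of_pos (by positivity)]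
      field_simp
      ring
    · rw [hx, e, Peakon.F_one_zero_eq hp hb, Peakon.G_eq hp hb]
      congr 1
      field_simp
      ring
    · rw [hm, e, Peakon.F_one_zero_eq hp hb, Peakon.F_two_one_eq hp hb, Peakon.G_eq hp hb]
      field_simp
      ring
  · rw [← Peakon.xmToYn_dpFormula hζ hp hb]
    exact Peakon.xmToYn_mem_phaseSpace (Peakon.dpFormula_mem_phaseSpace hζ hp hb)
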